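/- Let $\mathbf k$ be a commutative ring, $\lambda\in\mathbf k$ and $X$ a set. A Rota–Baxter algebra of weight $\lambda$ is an associative unitary $\mathbf k$-algebra $A$ with a linear operator $P$ such that $P(x)P(y)=P(xP(y))+P(P(x)y)+\lambda P(xy)$ for all $x,y\in A$; a nonunitary Rota–Baxter algebra is defined in the same way without requiring a unit. Homomorphisms are the (unit-preserving, in the unitary case) algebra homomorphisms that commute with the operators. **Words.** Let $\mathfrak M(X)$ be the monoid of bracketed words on $X$: the smallest $\mathfrak M$ with $\mathfrak M$ = free monoid on $X\sqcup\lfloor \mathfrak M\rfloor$, where $\lfloor \mathfrak M\rfloor=\{\lfloor W\rfloor : W\in \mathfrak M\}$ is a disjoint copy of $\mathfrak M$; its operator is $W\mapsto\lfloor W\rfloor$. Let $\mathfrak S(X)\subset\mathfrak M(X)$ be the operated subsemigroup generated by $X$ (the nonempty words in which no $\lfloor 1\rfloor$ occurs), and let $\mathfrak R(X)\subset\mathfrak M(X)$ be the set of Rota–Baxter bracketed words, those in which no closing bracket is immediately followed by an opening bracket. A word is indecomposable if it is $1$, some $x\in X$, or some $\lfloor W\rfloor$. **Paths.** Let $\mathfrak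 P(X)$ be the monoid, under the link product $\circ$ (concatenation), of Motzkin paths whose level steps are decorated by $X$; its operator $\mathfrak m\mapsto\langle\mathfrak m\rangle$ puts an up step before $\mathfrak m$ and a down step after it. Let $\mathfrak V(X)$ be the set of valley-free paths (no down step immediately followed by an up step) and $\mathfrak L(X)$ the set of peak-free paths (nontrivial, with no up step immediately followed by a down step). A path is indecomposable if it touches the $x$-axis at most at its two end points. Let $\phi:\mathfrak M(X)\to\mathfrak P(X)$ be the monoid homomorphism with $\phi(\lfloor W\rfloor)=\langle\phi(W)\rangle$ that sends $x\in X$ to the level step decorated by $x$. **Products.** For a set $Y$ let $\mathbf kY$ be the free $\mathbf k$-module with basis $Y$. There is a unique bilinear product $\diamond_w$ on $\mathbf k\mathfrak R(X)$ such that 1. $1$ is a two-sided identity; 2. if $W,W'\in\mathfrak R(X)$ are indecomposable and different from $1$, then $W\diamond_w W'=WW'$ (concatenation) when $W\in X$ or $W'\in X$, and $W\diamond_w W'=\lfloor U\diamond_w W'\rfloor+\lfloor W\diamond_w U'\rfloor+\lambda\lfloor U\diamond_w U'\rfloor$ when $W=\lfloor U\rfloor$ and $W'=\lfloor U'\rfloor$;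 3. if $W=W_1\cdots W_b$ and $W'=W'_1\cdots W'_{b'}$ are the decompositions of words $W,W'\in\mathfrak R(X)\setminus\{1\}$ into indecomposable words different from $1$, then $W\diamond_w W'=W_1\cdots W_{b-1}(W_b\diamond_w W'_1)W'_2\cdots W'_{b'}$. Likewise there is a unique bilinear product $\diamond_p$ on $\mathbf k\mathfrak V(X)$ with the corresponding properties: the trivial path, the link product, one-step level paths and $\langle\ \rangle$ replace $1$, concatenation, elements of $X$ and $\lfloor\ \rfloor$. These products restrict to $\mathbf k(\mathfrak S(X)\cap\mathfrak R(X))$ and $\mathbf k(\mathfrak L(X)\cap\mathfrak V(X))$ respectively. **Corollary.** 1. $(\mathbf k\mathfrak R(X),\diamond_w,\lfloor\ \rfloor)$ and $(\mathbf k\mathfrak V(X),\diamond_p,\langle\ \rangle)$ are Rota–Baxter algebras of weight $\lambda$, and $\mathbf k(\mathfrak S(X)\cap\mathfrak R(X))$ and $\mathbf k(\mathfrak L(X)\cap\mathfrak V(X))$, with the restricted products and operators, are nonunitary Rota–Baxter algebras of weight $\lambda$. The map $\phi$ restricts to bijections $\mathfrak R(X)\to\mathfrak V(X)$ and $\mathfrak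 S(X)\cap\mathfrak R(X)\to\mathfrak L(X)\cap\mathfrak V(X)$. The linear extension of the first one is an isomorphism of Rota–Baxter algebras $\mathbf k\mathfrak R(X)\cong\mathbf k\mathfrak V(X)$, and this restricts to an isomorphism of nonunitary Rota–Baxter algebras $\mathbf k(\mathfrak S(X)\cap\mathfrak R(X))\cong\mathbf k(\mathfrak L(X)\cap\mathfrak V(X))$. 2. With $j_X:X\to\mathfrak S(X)\cap\mathfrak R(X)\subset\mathfrak R(X)$, $j_X(x)=x$, the algebra $(\mathbf k\mathfrak R(X),\diamond_w,\lfloor\ \rfloor,j_X)$ is the free Rota–Baxter algebra of weight $\lambda$ on $X$, and $(\mathbf k(\mathfrak S(X)\cap\mathfrak R(X)),\diamond_w,\lfloor\ \rfloor,j_X)$ is the free nonunitary Rota–Baxter algebra of weight $\lambda$ on $X$: every map from $X$ to a Rota–Baxter algebra (respectively, a nonunitary one) of weight $\lambda$ factors uniquely as a homomorphism of such algebras composed with $j_X$. -/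

import Mathlib

namespace RotaBaxterWords

universe u v w

/-! ### Bracketed words

`BWord X` is the monoid of unitary bracketed words: it is the least solution of
`M = (free monoid on X ⊔ ⌊M⌋)`, i.e. the union of the chain of free monoids `M₀ = M(X)`,
`Mₙ = M(X ⊔ ⌊Mₙ₋₁⌋)`. A letter of such a word is either an element of `X` or a new symbol
`⌊W⌋` with `W` a bracketed word. -/

/-- The letters `x ∈ X` and `⌊W⌋`, `W` a bracketed word. -/
inductive BLetter (X : Type v) : Type v
  | var : X → BLetter X
  | br : List (BLetter X) → BLetter X

/-- The unitary bracketed words on `X`, with concatenation as product. -/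
abbrev BWord (X : Type v) : Type v := FreeMonoid (BLetter X)

variable {X : Type v}

/-- The word `x` of length one. -/
def BWord.var (x : X) : BWord X := FreeMonoid.of (BLetter.var x)

/-- The bracket operator `W ↦ ⌊W⌋`. -/
def BWord.bracket (W : BWord X) : BWord X := FreeMonoid.of (BLetter.br W.toList)

/-- The letter is of the form `⌊W⌋`. -/
def BLetter.IsBracket : BLetter X → Prop
  | .var _ => False
  | .br _ => True

/-- Rota--Baxter bracketed words: no closing bracket is immediately followed by an opening
bracket, i.e. at every depth no two consecutive letters are both of the form `⌊W⌋`. -/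
inductive IsRB : List (BLetter X) → Prop
  | mk (W : List (BLetter X))
      (adj : W.IsChain (fun a b => ¬ (a.IsBracket ∧ b.IsBracket)))
      (inner : ∀ U, BLetter.br U ∈ W → IsRB U) : IsRB W

/-- Nonunitary bracketed words: the least `S` consisting of all non-empty words in the
letters `x ∈ X` and `⌊U⌋` with `U ∈ S` (the union of the free semigroups `S₀ = S(X)`,
`Sₙ = S(X ⊔ ⌊Sₙ₋₁⌋)`). -/
inductive IsNonunitary : List (BLetter X) → Prop
  | mk (W : List (BLetter X)) (ne : W ≠ [])
      (inner : ∀ U, BLetter.br U ∈ W → IsNonunitary U) : IsNonunitary W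

/-- The set `R(X)` of Rota--Baxter bracketed words. -/
def wordR (X : Type v) : Set (BWord X) := {W | IsRB W.toList}

/-- The set `S(X)` of nonunitary bracketed words. -/
def wordS (X : Type v) : Set (BWord X) := {W | IsNonunitary W.toList}

/-- Indecomposable bracketed words: `1`, `x` and `⌊W⌋`. -/
def wordIndec (X : Type v) : Set (BWord X) :=
  {W | W = 1 ∨ (∃ x, W = BWord.var x) ∨ ∃ U, W = BWord.bracket U}

/-! ### Decorated Motzkin paths -/

/-- The steps of a path: up `(1,1)`, down `(1,-1)`, and level `(1,0)` decorated by `x ∈ X`. -/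
inductive Step (X : Type v) : Type v
  | up : Step X
  | down : Step X
  | level : X → Step X

/-- Vertical displacement of a step. -/
def Step.rise : Step X → ℤ
  | .up => 1
  | .down => -1
  | .level _ => 0

/-- Height of the end point of a sequence of steps starting at height `0`. -/
def height (l : List (Step X)) : ℤ := (l.map Step.rise).sum

/-- A sequence of steps starting at `(0,0)` is a Motzkin path if it never goes below the
`x`-axis and ends on it. -/
def IsMotzkin (l : List (Step X)) : Prop := (∀ n, 0 ≤ height (l.take n)) ∧ height l = 0

theorem height_append (l l' : List (Step X)) : height (l ++ l') = height l + height l' := by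
  simp [height]

theorem IsMotzkin.append {l l' : List (Step X)} (h : IsMotzkin l) (h' : IsMotzkin l') :
    IsMotzkin (l ++ l') := by
  refine ⟨fun n => ?_, by rw [height_append, h.2, h'.2]; rfl⟩
  rw [List.take_append, height_append]
  exact add_nonneg (h.1 _) (h'.1 _)

theorem IsMotzkin.raise {l : List (Step X)} (h : IsMotzkin l) :
    IsMotzkin (Step.up :: (l ++ [Step.down])) := by
  have key : ∀ n, 0 ≤ 1 + height ((l ++ [Step.down]).take n) := by
    intro n
    rw [List.take_append, height_append]
    by_cases hn : n ≤ l.length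
    · have := h.1 n
      simp [Nat.sub_eq_zero_of_le hn, height] at this ⊢
      linarith
    · have h1 : l.take n = l := List.take_of_length_le (by omega)
      obtain ⟨m, hm⟩ : ∃ m, n - l.length = m + 1 := ⟨n - l.length - 1, by omega⟩
      rw [h1, h.2, hm]
      simp [height, Step.rise]
  constructor
  · rintro (_ | n)
    · simp [height]
    · have := key n
      simpa [height, Step.rise] using this
  · have := h.2
    simp only [height, List.map_cons, List.map_append, List.sum_cons, List.sum_append,
      Step.rise] at this ⊢
    rw [this]; simp

/-- The monoid `P(X)` of Motzkin paths with level steps decorated by `X`, under the link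
product; the identity is the trivial path. -/
def motzkin (X : Type v) : Submonoid (FreeMonoid (Step X)) where
  carrier := {m | IsMotzkin m.toList}
  one_mem' := by simp [IsMotzkin, height]
  mul_mem' := fun {a b} ha hb => by
    simpa only [Set.mem_ofPred_eq, FreeMonoid.toList_mul] using IsMotzkin.append ha hb

abbrev MPath (X : Type v) : Type v := ↥(motzkin X)

/-- The sequence of steps of a path. -/
def MPath.steps (m : MPath X) : List (Step X) := m.1.toList

/-- The path consisting of one level step decorated by `x`. -/
def MPath.level (x : X) : MPath X :=
  ⟨FreeMonoid.of (Step.level x), by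
    refine ⟨?_, by simp [height, Step.rise]⟩
    rintro (_ | n) <;> simp [height, Step.rise]⟩

/-- The raising operator: an up step, the given path, a down step. -/
def MPath.raise (m : MPath X) : MPath X :=
  ⟨FreeMonoid.ofList (Step.up :: (m.steps ++ [Step.down])), IsMotzkin.raise m.2⟩

/-- The set `V(X)` of valley-free paths: no down step immediately followed by an up step. -/
def pathV (X : Type v) : Set (MPath X) := {m | ¬ [Step.down, Step.up] <:+: m.steps}

/-- The set `L(X)` of peak-free paths: non-trivial, and no up step immediately followed by a
down step. -/
def pathL (X : Type v) : Set (MPath X) := {m | m ≠ 1 ∧ ¬ [Step.up, Step.down] <:+: m.steps}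

/-- Indecomposable paths: those that touch the `x`-axis at most at their two end points. -/
def pathIndec (X : Type v) : Set (MPath X) :=
  {m | ∀ n, 0 < n → n < m.steps.length → 0 < height (m.steps.take n)}

/-! ### The map from bracketed words to paths -/

mutual
/-- The path of a letter. -/
def BLetter.toPath : BLetter X → MPath X
  | .var x => MPath.level x
  | .br W => MPath.raise (listToPath W)
/-- The path of a word: letters in order, joined by the link product. -/
def listToPath : List (BLetter X) → MPath X
  | [] => 1
  | a :: W => a.toPath * listToPath W
end

/-- The homomorphism of operated monoids from bracketed words to Motzkin paths that sends `x`
to the level step decorated by `x`. -/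
def toPath (W : BWord X) : MPath X := listToPath W.toList

theorem toPath_var (x : X) : toPath (BWord.var x) = MPath.level x := by
  simp [toPath, BWord.var, listToPath, BLetter.toPath]

theorem toPath_bracket (W : BWord X) : toPath W.bracket = (toPath W).raise := by
  simp [toPath, BWord.bracket, listToPath, BLetter.toPath]

theorem toPath_one : toPath (1 : BWord X) = 1 := by
  simp [toPath, listToPath]

theorem toPath_mul (W W' : BWord X) : toPath (W * W') = toPath W * toPath W' := by
  have : ∀ l l' : List (BLetter X), listToPath (l ++ l') = listToPath l * listToPath l' := by
    intro l l'
    induction l with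
    | nil => simp [listToPath]
    | cons a l ih => simp [listToPath, ih, mul_assoc]
  simpa [toPath] using this W.toList W'.toList

/-! ### Free modules on subsets, and operators on them -/

section Modules

variable (k : Type u) [CommRing k] {M : Type v}

/-- `kY`, the free module with basis `Y`, realized inside `kM` for a subset `Y` of `M`. -/
abbrev kSpan (Y : Set M) : Submodule k (M →₀ k) := Finsupp.supported k k Y

/-- The basis element of `kY` given by an element of `Y`. -/
noncomputable def bas {Y : Set M} (m : M) (hm : m ∈ Y) : kSpan k Y :=
  ⟨Finsupp.single m 1, Finsupp.single_mem_supported k 1 hm⟩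

variable {k}

theorem mapDomain_mem {N : Type v} {Y : Set M} {Z : Set N} (g : M → N)
    (h : ∀ m ∈ Y, g m ∈ Z) {a : M →₀ k} (ha : a ∈ kSpan k Y) :
    Finsupp.mapDomain g a ∈ kSpan k Z := by
  classical
  rw [Finsupp.mem_supported] at ha ⊢
  intro n hn
  obtain ⟨m, hm, rfl⟩ := Finset.mem_image.mp (Finsupp.mapDomain_support hn)
  exact h m (ha hm)

/-- The linear extension of an operator that maps `Y` to itself. -/
noncomputable def opOn {Y : Set M} (op : M → M) (h : ∀ m ∈ Y, op m ∈ Y) :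
    kSpan k Y →ₗ[k] kSpan k Y :=
  (Finsupp.lmapDomain k k op).restrict (fun _ ha => mapDomain_mem op h ha)

/-- The bilinear extension to `kM` of a product `M × M → kM`. -/
noncomputable def bilin (f : M → M → (M →₀ k)) :
    (M →₀ k) →ₗ[k] (M →₀ k) →ₗ[k] (M →₀ k) :=
  Finsupp.linearCombination k (fun m => Finsupp.linearCombination k (f m))

theorem bilin_mem {Y : Set M} (f : M → M → (M →₀ k))
    (h : ∀ m ∈ Y, ∀ m' ∈ Y, f m m' ∈ kSpan k Y) {a b : M →₀ k}
    (ha : a ∈ kSpan k Y) (hb : b ∈ kSpan k Y) : bilin f a b ∈ kSpan k Y := by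
  rw [Finsupp.mem_supported] at ha hb
  rw [bilin, Finsupp.linearCombination_apply, Finsupp.sum, LinearMap.sum_apply]
  refine Submodule.sum_mem _ fun m hm => ?_
  rw [LinearMap.smul_apply, Finsupp.linearCombination_apply, Finsupp.sum]
  exact Submodule.smul_mem _ _ (Submodule.sum_mem _ fun m' hm' =>
    Submodule.smul_mem _ _ (h m (ha hm) m' (hb hm')))

/-- The bilinear product on `kY` extending a product `Y × Y → kY`. -/
noncomputable def bilinOn {Y : Set M} (f : M → M → (M →₀ k))
    (h : ∀ m ∈ Y, ∀ m' ∈ Y, f m m' ∈ kSpan k Y) :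
    kSpan k Y →ₗ[k] kSpan k Y →ₗ[k] kSpan k Y :=
  LinearMap.mk₂ k (fun a b => ⟨bilin f a.1 b.1, bilin_mem f h a.2 b.2⟩)
    (fun a a' b => by ext1; simp) (fun c a b => by ext1; simp)
    (fun a b b' => by ext1; simp) (fun c a b => by ext1; simp)

end Modules

/-! ### The product on bracketed words -/

section WordProduct

variable {k : Type u} [CommRing k]

/-- The product of two bracketed words. If the last letter of `W` is `⌊U⌋` and the first
letter of `W'` is `⌊T⌋`, say `W = A⌊U⌋` and `W' = ⌊T⌋B`, it is
`A (⌊U ⋄ ⌊T⌋⌋ + ⌊⌊U⌋ ⋄ T⌋ + lam ⌊U ⋄ T⌋) B`; in all other cases it is the concatenation. -/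
noncomputable def wordProd (lam : k) (W W' : List (BLetter X)) : BWord X →₀ k :=
  match h : W.getLast?, h' : W'.head? with
  | some (BLetter.br U), some (BLetter.br T) =>
    Finsupp.mapDomain
      (fun Z => FreeMonoid.ofList W.dropLast * BWord.bracket Z * FreeMonoid.ofList W'.tail)
      (wordProd lam U [BLetter.br T] + wordProd lam [BLetter.br U] T + lam • wordProd lam U T)
  | _, _ => Finsupp.single (FreeMonoid.ofList (W ++ W')) 1
termination_by sizeOf W + sizeOf W'
decreasing_by
  all_goals
    obtain ⟨A, rfl⟩ := List.getLast?_eq_some_iff.mp h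
    obtain ⟨B, rfl⟩ := List.head?_eq_some_iff.mp h'
    have := List.sizeOf_lt_of_mem
      (List.mem_append_right A (List.mem_singleton_self (BLetter.br U)))
    simp at this ⊢
    omega

theorem wordProd_br (lam : k) (A B U T : List (BLetter X)) :
    wordProd lam (A ++ [BLetter.br U]) (BLetter.br T :: B) =
      Finsupp.mapDomain
        (fun Z => FreeMonoid.ofList A * BWord.bracket Z * FreeMonoid.ofList B)
        (wordProd lam U [BLetter.br T] + wordProd lam [BLetter.br U] T +
          lam • wordProd lam U T) := by
  rw [wordProd]
  split
  · rename_i U' T' h h'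
    have e1 : U = U' := by simpa using h
    have e2 : T = T' := by simpa using h'
    subst e1 e2
    simp
  · rename_i h
    exact (h U T (by simp) (by simp)).elim

theorem wordProd_cases (lam : k) (W W' : List (BLetter X)) :
    (∃ A U T B, W = A ++ [BLetter.br U] ∧ W' = BLetter.br T :: B) ∨
    ((∀ a ∈ W.getLast?, ∀ b ∈ W'.head?, ¬ (a.IsBracket ∧ b.IsBracket)) ∧
      wordProd lam W W' = Finsupp.single (FreeMonoid.ofList (W ++ W')) 1) := by
  by_cases h : ∃ A U T B, W = A ++ [BLetter.br U] ∧ W' = BLetter.br T :: B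
  · exact Or.inl h
  · right
    constructor
    · rintro a ha b hb ⟨h1, h2⟩
      obtain ⟨A, rfl⟩ := List.getLast?_eq_some_iff.mp ha
      obtain ⟨B, rfl⟩ := List.head?_eq_some_iff.mp hb
      cases a <;> cases b <;> simp [BLetter.IsBracket] at h1 h2
      exact h ⟨_, _, _, _, rfl, rfl⟩
    · rw [wordProd]
      split
      · rename_i U T h1 h2
        obtain ⟨A, rfl⟩ := List.getLast?_eq_some_iff.mp h1
        obtain ⟨B, rfl⟩ := List.head?_eq_some_iff.mp h2
        exact absurd ⟨_, _, _, _, rfl, rfl⟩ h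
      · rfl

theorem isRB_iff (W : List (BLetter X)) : IsRB W ↔
    W.IsChain (fun a b => ¬ (a.IsBracket ∧ b.IsBracket)) ∧
      ∀ U, BLetter.br U ∈ W → IsRB U :=
  ⟨fun h => by cases h; constructor <;> assumption, fun h => ⟨_, h.1, h.2⟩⟩

theorem isNonunitary_iff (W : List (BLetter X)) : IsNonunitary W ↔
    W ≠ [] ∧ ∀ U, BLetter.br U ∈ W → IsNonunitary U :=
  ⟨fun h => by cases h; constructor <;> assumption, fun h => ⟨_, h.1, h.2⟩⟩

/-- A set of words closed under the steps of the recursion is closed under the product. -/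
theorem wordProd_mem (lam : k) (Y : Set (BWord X))
    (hU : ∀ A U, FreeMonoid.ofList (A ++ [BLetter.br U]) ∈ Y →
      FreeMonoid.ofList U ∈ Y ∧ FreeMonoid.ofList [BLetter.br U] ∈ Y)
    (hT : ∀ T B, FreeMonoid.ofList (BLetter.br T :: B) ∈ Y →
      FreeMonoid.ofList T ∈ Y ∧ FreeMonoid.ofList [BLetter.br T] ∈ Y)
    (hZ : ∀ A U T B Z, FreeMonoid.ofList (A ++ [BLetter.br U]) ∈ Y →
      FreeMonoid.ofList (BLetter.br T :: B) ∈ Y → FreeMonoid.ofList Z ∈ Y →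
      FreeMonoid.ofList (A ++ BLetter.br Z :: B) ∈ Y)
    (hc : ∀ W W' : List (BLetter X), FreeMonoid.ofList W ∈ Y → FreeMonoid.ofList W' ∈ Y →
      (∀ a ∈ W.getLast?, ∀ b ∈ W'.head?, ¬ (a.IsBracket ∧ b.IsBracket)) →
      FreeMonoid.ofList (W ++ W') ∈ Y) :
    ∀ W W' : List (BLetter X), FreeMonoid.ofList W ∈ Y → FreeMonoid.ofList W' ∈ Y →
      wordProd lam W W' ∈ kSpan k Y := by
  suffices H : ∀ n, ∀ W W' : List (BLetter X), sizeOf W + sizeOf W' = n →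
      FreeMonoid.ofList W ∈ Y → FreeMonoid.ofList W' ∈ Y → wordProd lam W W' ∈ kSpan k Y from
    fun W W' => H _ W W' rfl
  intro n
  induction n using Nat.strong_induction_on with
  | _ n ih =>
    rintro W W' rfl hW hW'
    rcases wordProd_cases lam W W' with ⟨A, U, T, B, rfl, rfl⟩ | ⟨h, e⟩
    · rw [wordProd_br]
      obtain ⟨hU1, hU2⟩ := hU _ _ hW
      obtain ⟨hT1, hT2⟩ := hT _ _ hW'
      have hs := List.sizeOf_lt_of_mem
        (List.mem_append_right A (List.mem_singleton_self (BLetter.br U)))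
      simp at hs
      refine mapDomain_mem _ (Y := Y) (fun Z hZY => ?_) ?_
      · have := hZ A U T B Z.toList hW hW' hZY
        simpa [BWord.bracket, FreeMonoid.ofList_append, FreeMonoid.ofList_cons, mul_assoc]
          using this
      · refine add_mem (add_mem ?_ ?_) (Submodule.smul_mem _ _ ?_)
        · exact ih _ (by simp; omega) _ _ rfl hU1 hT2
        · exact ih _ (by simp; omega) _ _ rfl hU2 hT1
        · exact ih _ (by simp; omega) _ _ rfl hU1 hT1
    · rw [e]
      exact Finsupp.single_mem_supported k 1 (hc W W' hW hW' h)

theorem wordProd_mem_R (lam : k) : ∀ W ∈ wordR X, ∀ W' ∈ wordR X,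
    wordProd lam W.toList W'.toList ∈ kSpan k (wordR X) := by
  intro W hW W' hW'
  refine wordProd_mem lam (wordR X) ?_ ?_ ?_ ?_ W.toList W'.toList hW hW'
  · intro A U h
    have h1 : IsRB (A ++ [BLetter.br U]) := h
    rw [isRB_iff] at h1
    have h2 : IsRB U := h1.2 U (by simp)
    exact ⟨h2, (isRB_iff _).mpr ⟨by simp, by simpa using h2⟩⟩
  · intro T B h
    have h1 : IsRB (BLetter.br T :: B) := h
    rw [isRB_iff] at h1
    have h2 : IsRB T := h1.2 T (by simp)
    exact ⟨h2, (isRB_iff _).mpr ⟨by simp, by simpa using h2⟩⟩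
  · intro A U T B Z h h' hZ
    have h1 : IsRB (A ++ [BLetter.br U]) := h
    have h2 : IsRB (BLetter.br T :: B) := h'
    have h3 : IsRB Z := hZ
    change IsRB (A ++ BLetter.br Z :: B)
    rw [isRB_iff] at h1 h2 ⊢
    refine ⟨?_, ?_⟩
    · have c1 := List.isChain_append.mp h1.1
      have c2 := List.isChain_cons.mp h2.1
      refine List.isChain_append.mpr ⟨c1.1, List.isChain_cons.mpr ⟨?_, c2.2⟩, ?_⟩
      · intro b hb
        simpa [BLetter.IsBracket] using c2.1 b hb
      · intro a ha b hb
        have := c1.2.2 a ha (BLetter.br U) (by simp)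
        have e : BLetter.br Z = b := by simpa using hb
        subst e
        simpa [BLetter.IsBracket] using this
    · intro V hV
      rcases List.mem_append.mp hV with hV | hV
      · exact h1.2 V (by simp [hV])
      · rcases List.mem_cons.mp hV with hV | hV
        · cases hV; exact h3
        · exact h2.2 V (by simp [hV])
  · intro V V' h h' hadj
    have h1 : IsRB V := h
    have h2 : IsRB V' := h'
    change IsRB (V ++ V')
    rw [isRB_iff] at h1 h2 ⊢
    refine ⟨List.isChain_append.mpr ⟨h1.1, h2.1, hadj⟩, fun U hU => ?_⟩
    rcases List.mem_append.mp hU with hU | hU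
    · exact h1.2 U hU
    · exact h2.2 U hU

theorem wordProd_mem_S (lam : k) : ∀ W ∈ wordS X, ∀ W' ∈ wordS X,
    wordProd lam W.toList W'.toList ∈ kSpan k (wordS X) := by
  intro W hW W' hW'
  refine wordProd_mem lam (wordS X) ?_ ?_ ?_ ?_ W.toList W'.toList hW hW'
  · intro A U h
    have h1 : IsNonunitary (A ++ [BLetter.br U]) := h
    rw [isNonunitary_iff] at h1
    have h2 : IsNonunitary U := h1.2 U (by simp)
    exact ⟨h2, (isNonunitary_iff _).mpr ⟨by simp, by simpa using h2⟩⟩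
  · intro T B h
    have h1 : IsNonunitary (BLetter.br T :: B) := h
    rw [isNonunitary_iff] at h1
    have h2 : IsNonunitary T := h1.2 T (by simp)
    exact ⟨h2, (isNonunitary_iff _).mpr ⟨by simp, by simpa using h2⟩⟩
  · intro A U T B Z h h' hZ
    have h1 : IsNonunitary (A ++ [BLetter.br U]) := h
    have h2 : IsNonunitary (BLetter.br T :: B) := h'
    have h3 : IsNonunitary Z := hZ
    change IsNonunitary (A ++ BLetter.br Z :: B)
    rw [isNonunitary_iff] at h1 h2 ⊢
    refine ⟨by simp, fun V hV => ?_⟩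
    rcases List.mem_append.mp hV with hV | hV
    · exact h1.2 V (by simp [hV])
    · rcases List.mem_cons.mp hV with hV | hV
      · cases hV; exact h3
      · exact h2.2 V (by simp [hV])
  · intro V V' h h' _
    have h1 : IsNonunitary V := h
    have h2 : IsNonunitary V' := h'
    change IsNonunitary (V ++ V')
    rw [isNonunitary_iff] at h1 h2 ⊢
    refine ⟨by simp [h1.1], fun U hU => ?_⟩
    rcases List.mem_append.mp hU with hU | hU
    · exact h1.2 U hU
    · exact h2.2 U hU

theorem wordProd_mem_SR (lam : k) : ∀ W ∈ wordS X ∩ wordR X, ∀ W' ∈ wordS X ∩ wordR X,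
    wordProd lam W.toList W'.toList ∈ kSpan k (wordS X ∩ wordR X) := by
  intro W hW W' hW'
  rw [kSpan, Finsupp.supported_inter]
  exact ⟨wordProd_mem_S lam W hW.1 W' hW'.1, wordProd_mem_R lam W hW.2 W' hW'.2⟩

theorem one_mem_wordR : (1 : BWord X) ∈ wordR X :=
  (isRB_iff _).mpr (by simp)

theorem bracket_mem_wordR : ∀ W ∈ wordR X, BWord.bracket W ∈ wordR X := fun W hW =>
  (isRB_iff _).mpr ⟨by simp [BWord.bracket], fun U hU => by
    have e : U = W.toList := by simpa [BWord.bracket] using hU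
    rw [e]; exact hW⟩

theorem bracket_mem_wordS : ∀ W ∈ wordS X, BWord.bracket W ∈ wordS X := fun W hW =>
  (isNonunitary_iff _).mpr ⟨by simp [BWord.bracket], fun U hU => by
    have e : U = W.toList := by simpa [BWord.bracket] using hU
    rw [e]; exact hW⟩

theorem bracket_mem_wordSR : ∀ W ∈ wordS X ∩ wordR X, BWord.bracket W ∈ wordS X ∩ wordR X :=
  fun W hW => ⟨bracket_mem_wordS W hW.1, bracket_mem_wordR W hW.2⟩

theorem var_mem_wordSR (x : X) : BWord.var x ∈ wordS X ∩ wordR X :=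
  ⟨(isNonunitary_iff _).mpr (by simp [BWord.var]), (isRB_iff _).mpr (by simp [BWord.var])⟩

/-- The product `⋄` on `kR(X)`. -/
noncomputable def mulR (k : Type u) [CommRing k] (X : Type v) (lam : k) :
    kSpan k (wordR X) →ₗ[k] kSpan k (wordR X) →ₗ[k] kSpan k (wordR X) :=
  bilinOn (fun W W' => wordProd lam W.toList W'.toList) (wordProd_mem_R lam)

/-- The product `⋄` on `k(S(X) ∩ R(X))`, by the same formula on basis elements. -/
noncomputable def mulSR (k : Type u) [CommRing k] (X : Type v) (lam : k) :
    kSpan k (wordS X ∩ wordR X) →ₗ[k] kSpan k (wordS X ∩ wordR X) →ₗ[k]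
      kSpan k (wordS X ∩ wordR X) :=
  bilinOn (fun W W' => wordProd lam W.toList W'.toList) (wordProd_mem_SR lam)

/-- The product on `k(S(X) ∩ R(X))` is the restriction of the one on `kR(X)`. -/
theorem coe_mulSR (k : Type u) [CommRing k] (lam : k) (a b : kSpan k (wordS X ∩ wordR X))
    (ha : (a : BWord X →₀ k) ∈ kSpan k (wordR X)) (hb : (b : BWord X →₀ k) ∈ kSpan k (wordR X)) :
    (mulSR k X lam a b : BWord X →₀ k) = mulR k X lam ⟨a, ha⟩ ⟨b, hb⟩ := rfl

/-- The bracket operator on `kR(X)`. -/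
noncomputable def opR (k : Type u) [CommRing k] (X : Type v) :
    kSpan k (wordR X) →ₗ[k] kSpan k (wordR X) :=
  opOn BWord.bracket bracket_mem_wordR

/-- The bracket operator on `k(S(X) ∩ R(X))`. -/
noncomputable def opSR (k : Type u) [CommRing k] (X : Type v) :
    kSpan k (wordS X ∩ wordR X) →ₗ[k] kSpan k (wordS X ∩ wordR X) :=
  opOn BWord.bracket bracket_mem_wordSR

end WordProduct

/-! ### The product on Motzkin paths -/

section PathProduct

variable {k : Type u} [CommRing k]

theorem steps_mul (m m' : MPath X) : (m * m').steps = m.steps ++ m'.steps := by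
  simp [MPath.steps]

theorem steps_raise (m : MPath X) : m.raise.steps = Step.up :: (m.steps ++ [Step.down]) := by
  simp [MPath.steps, MPath.raise]

theorem steps_one : (1 : MPath X).steps = [] := by
  simp [MPath.steps]

open Classical in
/-- The product of two Motzkin paths. If the last indecomposable factor of `m` and the first
indecomposable factor of `m'` are both raised paths, say `m = a ∘ raise u` and
`m' = raise t ∘ b` (such `a`, `u`, `t`, `b` are unique), it is
`a ∘ (raise (u ⋄ raise t) + raise (raise u ⋄ t) + lam raise (u ⋄ t)) ∘ b`; in all other cases
it is the link product. -/
noncomputable def pathProd (lam : k) (m m' : MPath X) : MPath X →₀ k :=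
  if h : (∃ c : MPath X × MPath X, m = c.1 * c.2.raise) ∧
      (∃ c : MPath X × MPath X, m' = c.1.raise * c.2) then
    Finsupp.mapDomain (fun z => h.1.choose.1 * MPath.raise z * h.2.choose.2)
      (pathProd lam h.1.choose.2 h.2.choose.1.raise +
        pathProd lam h.1.choose.2.raise h.2.choose.1 +
        lam • pathProd lam h.1.choose.2 h.2.choose.1)
  else Finsupp.single (m * m') 1
termination_by m.steps.length + m'.steps.length
decreasing_by
  all_goals
    have e := congrArg (fun p => p.steps.length) h.1.choose_spec
    have e' := congrArg (fun p => p.steps.length) h.2.choose_spec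
    simp only [steps_mul, steps_raise, List.length_append, List.length_cons,
      List.length_nil] at e e' ⊢
    omega

theorem pathProd_cases (lam : k) (m m' : MPath X) :
    (∃ a u t b, m = a * MPath.raise u ∧ m' = MPath.raise t * b ∧ pathProd lam m m' =
      Finsupp.mapDomain (fun z => a * MPath.raise z * b)
        (pathProd lam u t.raise + pathProd lam u.raise t + lam • pathProd lam u t)) ∨
    ((¬ ((∃ a u, m = a * MPath.raise u) ∧ ∃ t b, m' = MPath.raise t * b)) ∧
      pathProd lam m m' = Finsupp.single (m * m') 1) := by
  by_cases h : (∃ c : MPath X × MPath X, m = c.1 * c.2.raise) ∧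
      (∃ c : MPath X × MPath X, m' = c.1.raise * c.2)
  · left
    refine ⟨_, _, _, _, h.1.choose_spec, h.2.choose_spec, ?_⟩
    conv_lhs => rw [pathProd]
    rw [dif_pos h]
  · right
    refine ⟨fun ⟨⟨a, u, h1⟩, ⟨t, b, h2⟩⟩ => h ⟨⟨(a, u), h1⟩, ⟨(t, b), h2⟩⟩, ?_⟩
    rw [pathProd, dif_neg h]

/-- A set of paths closed under the steps of the recursion is closed under the product. -/
theorem pathProd_mem (lam : k) (Y : Set (MPath X))
    (hl : ∀ a u : MPath X, a * u.raise ∈ Y → u ∈ Y ∧ u.raise ∈ Y)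
    (hr : ∀ t b : MPath X, t.raise * b ∈ Y → t ∈ Y ∧ t.raise ∈ Y)
    (hz : ∀ a u t b z : MPath X, a * u.raise ∈ Y → t.raise * b ∈ Y → z ∈ Y →
      a * z.raise * b ∈ Y)
    (hc : ∀ m m' : MPath X, m ∈ Y → m' ∈ Y →
      ¬ ((∃ a u, m = a * MPath.raise u) ∧ ∃ t b, m' = MPath.raise t * b) → m * m' ∈ Y) :
    ∀ m ∈ Y, ∀ m' ∈ Y, pathProd lam m m' ∈ kSpan k Y := by
  suffices H : ∀ n, ∀ m m' : MPath X, m.steps.length + m'.steps.length = n →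
      m ∈ Y → m' ∈ Y → pathProd lam m m' ∈ kSpan k Y from
    fun m hm m' hm' => H _ m m' rfl hm hm'
  intro n
  induction n using Nat.strong_induction_on with
  | _ n ih =>
    rintro m m' rfl hm hm'
    rcases pathProd_cases lam m m' with ⟨a, u, t, b, rfl, rfl, e⟩ | ⟨h, e⟩
    · rw [e]
      obtain ⟨hu1, hu2⟩ := hl _ _ hm
      obtain ⟨ht1, ht2⟩ := hr _ _ hm'
      refine mapDomain_mem _ (Y := Y) (fun z hzY => hz a u t b z hm hm' hzY) ?_
      refine add_mem (add_mem ?_ ?_) (Submodule.smul_mem _ _ ?_)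
      · exact ih _ (by simp [steps_mul, steps_raise]; omega) _ _ rfl hu1 ht2
      · exact ih _ (by simp [steps_mul, steps_raise]; omega) _ _ rfl hu2 ht1
      · exact ih _ (by simp [steps_mul, steps_raise]; omega) _ _ rfl hu1 ht1
    · rw [e]
      exact Finsupp.single_mem_supported k 1 (hc m m' hm hm' h)

/-- Avoiding a factor `[s, s']` means that it never occurs as two consecutive entries. -/
theorem not_infix_iff (s s' : Step X) (l : List (Step X)) :
    ¬ [s, s'] <:+: l ↔ l.IsChain (fun a b => ¬ (a = s ∧ b = s')) := by
  rw [List.isChain_iff_forall_rel_of_append_cons_cons]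
  constructor
  · rintro h a b l₁ l₂ rfl ⟨rfl, rfl⟩
    exact h ⟨l₁, l₂, by simp⟩
  · rintro h ⟨l₁, l₂, rfl⟩
    exact h (a := s) (b := s') (l₁ := l₁) (l₂ := l₂) (by simp) ⟨rfl, rfl⟩

/-- A path that starts with an up step splits off a raised path on the left. -/
theorem exists_raise_mul (m : MPath X) (l : List (Step X)) (hm : m.steps = Step.up :: l) :
    ∃ t b : MPath X, m = t.raise * b := by
  classical
  have hM : IsMotzkin (Step.up :: l) := hm ▸ m.2
  have hl : height l = -1 := by
    have := hM.2
    simp only [height, List.map_cons, List.sum_cons, Step.rise] at this ⊢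
    omega
  have hpre : ∀ n, 0 ≤ 1 + height (l.take n) := fun n => by
    have := hM.1 (n + 1)
    simpa [height, Step.rise] using this
  have hex : ∃ n, height (l.take n) < 0 := ⟨l.length, by simp [hl]⟩
  obtain ⟨n, hn⟩ : ∃ n, Nat.find hex = n := ⟨_, rfl⟩
  have h1 : height (l.take n) < 0 := hn ▸ Nat.find_spec hex
  have h2 : ∀ j < n, 0 ≤ height (l.take j) := fun j hj =>
    not_lt.mp (Nat.find_min hex (hn.symm ▸ hj))
  rcases n with _ | n
  · simp [height] at h1
  have hlt : n < l.length := by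
    by_contra hge
    have := h2 n (Nat.lt_succ_self n)
    rw [List.take_of_length_le (by omega)] at this h1
    omega
  have hsplit : l.take n ++ l[n] :: l.drop (n + 1) = l := by
    rw [← List.drop_eq_getElem_cons hlt, List.take_append_drop]
  have h3 : height (l.take (n + 1)) = height (l.take n) + (l[n]).rise := by
    rw [List.take_succ_eq_append_getElem hlt, height_append]
    simp [height]
  have h4 := h2 n (Nat.lt_succ_self n)
  have hd : l[n] = Step.down := by
    cases hs : l[n] <;> rw [hs] at h3 <;> simp only [Step.rise] at h3 <;>
      first | rfl | omega
  have h5 : height (l.take n) = 0 := by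
    rw [hd] at h3; simp only [Step.rise] at h3; omega
  have ht : IsMotzkin (l.take n) := by
    refine ⟨fun j => ?_, h5⟩
    rw [List.take_take]
    exact h2 _ (by omega)
  have h6 : height (l.take (n + 1)) = -1 := by
    rw [h3, h5, hd]; rfl
  have hb : IsMotzkin (l.drop (n + 1)) := by
    refine ⟨fun j => ?_, ?_⟩
    · have := hpre (n + 1 + j)
      rw [List.take_add, height_append] at this
      omega
    · have := congrArg height (List.take_append_drop (n + 1) l)
      rw [height_append] at this
      omega
  refine ⟨⟨FreeMonoid.ofList _, ht⟩, ⟨FreeMonoid.ofList _, hb⟩, ?_⟩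
  apply Subtype.ext
  apply FreeMonoid.toList.injective
  change m.steps = _
  rw [hm]
  conv_lhs => rw [← hsplit, hd]
  simp [MPath.raise, MPath.steps]

/-- A path that ends with a down step splits off a raised path on the right. -/
theorem exists_mul_raise (m : MPath X) (l : List (Step X)) (hm : m.steps = l ++ [Step.down]) :
    ∃ a u : MPath X, m = a * u.raise := by
  suffices H : ∀ n, ∀ m : MPath X, m.steps.length = n →
      m.steps.getLast? = some Step.down → ∃ a u : MPath X, m = a * u.raise from
    H _ m rfl (by simp [hm])
  intro n
  induction n using Nat.strong_induction_on with
  | _ n ih =>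
    rintro m rfl h
    obtain ⟨p, b, hp, hne, e⟩ : ∃ p b : MPath X, ((∃ t, p = MPath.raise t) ∨
        ∃ x, p = MPath.level x) ∧ p.steps ≠ [] ∧ m = p * b := by
      rcases hs : m.steps with _ | ⟨s, l⟩
      · simp [hs] at h
      · rcases s with _ | _ | x
        · obtain ⟨t, b, e⟩ := exists_raise_mul m l hs
          exact ⟨t.raise, b, Or.inl ⟨t, rfl⟩, by simp [steps_raise], e⟩
        · have : IsMotzkin (Step.down :: l) := hs ▸ m.2
          have := this.1 1
          simp [height, Step.rise] at this
        · have hM : IsMotzkin (Step.level x :: l) := hs ▸ m.2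
          have hb : IsMotzkin l := by
            refine ⟨fun j => ?_, ?_⟩
            · have := hM.1 (j + 1)
              simpa [height, Step.rise] using this
            · have := hM.2
              simpa [height, Step.rise] using this
          refine ⟨MPath.level x, ⟨FreeMonoid.ofList l, hb⟩, Or.inr ⟨x, rfl⟩,
            by simp [MPath.steps, MPath.level], ?_⟩
          apply Subtype.ext
          apply FreeMonoid.toList.injective
          change m.steps = _
          rw [hs]
          simp [MPath.level]
    subst e
    by_cases hb : b.steps = []
    · have hb1 : b = 1 := Subtype.ext (FreeMonoid.toList.injective hb)
      subst hb1
      rcases hp with ⟨t, rfl⟩ | ⟨x, rfl⟩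
      · exact ⟨1, t, by simp⟩
      · simp [MPath.steps, MPath.level] at h
    · have hlen : 0 < p.steps.length := List.length_pos_iff.mpr hne
      obtain ⟨a, u, rfl⟩ := ih b.steps.length (by rw [steps_mul, List.length_append]; omega) b rfl
        (by rwa [steps_mul, List.getLast?_append_of_ne_nil _ hb] at h)
      exact ⟨p * a, u, by rw [mul_assoc]⟩

theorem mem_pathV_iff (m : MPath X) : m ∈ pathV X ↔
    m.steps.IsChain (fun a b => ¬ (a = Step.down ∧ b = Step.up)) :=
  not_infix_iff _ _ _

theorem mem_pathL_iff (m : MPath X) : m ∈ pathL X ↔ m.steps ≠ [] ∧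
    m.steps.IsChain (fun a b => ¬ (a = Step.up ∧ b = Step.down)) := by
  have : m ≠ 1 ↔ m.steps ≠ [] := by
    refine not_congr ⟨fun h => h ▸ steps_one, fun h => ?_⟩
    exact Subtype.ext (FreeMonoid.toList.injective h)
  rw [← not_infix_iff, ← this]
  rfl

/-- The first step of a path is not a down step. -/
theorem head_ne_down (m : MPath X) : Step.down ∉ m.steps.head? := by
  intro h
  obtain ⟨l, hl⟩ := List.head?_eq_some_iff.mp h
  have : IsMotzkin (Step.down :: l) := hl ▸ m.2
  have := this.1 1
  simp [height, Step.rise] at this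

/-- The last step of a path is not an up step. -/
theorem last_ne_up (m : MPath X) : Step.up ∉ m.steps.getLast? := by
  intro h
  obtain ⟨l, hl⟩ := List.getLast?_eq_some_iff.mp h
  have hM : IsMotzkin (l ++ [Step.up]) := hl ▸ m.2
  have h1 := hM.1 l.length
  have h2 := hM.2
  rw [height_append] at h2
  simp [height, Step.rise] at h1 h2
  omega

theorem raise_mem_pathV : ∀ m ∈ pathV X, MPath.raise m ∈ pathV X := by
  intro m hm
  rw [mem_pathV_iff] at hm ⊢
  rw [steps_raise]
  refine List.isChain_cons.mpr ⟨by simp, List.isChain_append.mpr ⟨hm, by simp, by simp⟩⟩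

theorem raise_mem_pathL : ∀ m ∈ pathL X, MPath.raise m ∈ pathL X := by
  intro m hm
  rw [mem_pathL_iff] at hm ⊢
  rw [steps_raise]
  refine ⟨by simp, List.isChain_cons.mpr ⟨?_, List.isChain_append.mpr ⟨hm.2, by simp, ?_⟩⟩⟩
  · rintro y hy ⟨-, rfl⟩
    rw [List.head?_append_of_ne_nil _ hm.1] at hy
    exact head_ne_down m hy
  · rintro x hx y - ⟨rfl, -⟩
    exact last_ne_up m hx

theorem mem_of_raise_mem_pathV (m : MPath X) (h : m.raise ∈ pathV X) : m ∈ pathV X := by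
  rw [mem_pathV_iff] at h ⊢
  rw [steps_raise] at h
  exact (List.isChain_append.mp (List.isChain_cons.mp h).2).1

theorem mem_of_raise_mem_pathL (m : MPath X) (h : m.raise ∈ pathL X) : m ∈ pathL X := by
  rw [mem_pathL_iff] at h ⊢
  rw [steps_raise] at h
  have h2 := List.isChain_cons.mp h.2
  refine ⟨fun h0 => ?_, (List.isChain_append.mp h2.2).1⟩
  rw [h0] at h2
  exact h2.1 Step.down (by simp) ⟨rfl, rfl⟩

theorem pathProd_mem_V (lam : k) : ∀ m ∈ pathV X, ∀ m' ∈ pathV X,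
    pathProd lam m m' ∈ kSpan k (pathV X) := by
  have hL : ∀ a b : MPath X, a * b ∈ pathV X → a ∈ pathV X ∧ b ∈ pathV X := by
    intro a b h
    simp only [mem_pathV_iff, steps_mul] at h ⊢
    exact ⟨(List.isChain_append.mp h).1, (List.isChain_append.mp h).2.1⟩
  refine pathProd_mem lam (pathV X) ?_ ?_ ?_ ?_
  · exact fun a u h => ⟨mem_of_raise_mem_pathV u (hL _ _ h).2, (hL _ _ h).2⟩
  · exact fun t b h => ⟨mem_of_raise_mem_pathV t (hL _ _ h).1, (hL _ _ h).1⟩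
  · intro a u t b z h h' hz
    have hz' := raise_mem_pathV z hz
    rw [mem_pathV_iff] at h h' hz' ⊢
    rw [steps_mul] at h h'
    have c := List.isChain_append.mp h
    have c' := List.isChain_append.mp h'
    rw [steps_mul, steps_mul]
    refine List.isChain_append.mpr ⟨List.isChain_append.mpr ⟨c.1, hz', ?_⟩, c'.2.1, ?_⟩
    · rintro x hx y hy
      exact c.2.2 x hx y (by simpa [steps_raise] using hy)
    · rintro x hx y hy
      refine c'.2.2 x ?_ y hy
      have e1 : (a.steps ++ z.raise.steps).getLast? = some Step.down := by
        rw [steps_raise, ← List.cons_append, ← List.append_assoc]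
        exact List.getLast?_concat
      have e2 : t.raise.steps.getLast? = some Step.down := by
        rw [steps_raise, ← List.cons_append]
        exact List.getLast?_concat
      rw [e1] at hx
      rwa [e2]
  · intro m m' h h' hn
    rw [mem_pathV_iff] at h h' ⊢
    rw [steps_mul]
    refine List.isChain_append.mpr ⟨h, h', ?_⟩
    rintro x hx y hy ⟨rfl, rfl⟩
    obtain ⟨l, hl⟩ := List.getLast?_eq_some_iff.mp hx
    obtain ⟨l', hl'⟩ := List.head?_eq_some_iff.mp hy
    exact hn ⟨exists_mul_raise m l hl, exists_raise_mul m' l' hl'⟩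

theorem pathProd_mem_L (lam : k) : ∀ m ∈ pathL X, ∀ m' ∈ pathL X,
    pathProd lam m m' ∈ kSpan k (pathL X) := by
  have hc : ∀ a b : MPath X,
      a.steps.IsChain (fun a b => ¬ (a = Step.up ∧ b = Step.down)) →
      b.steps.IsChain (fun a b => ¬ (a = Step.up ∧ b = Step.down)) →
      (a * b).steps.IsChain (fun a b => ¬ (a = Step.up ∧ b = Step.down)) := by
    intro a b ha hb
    rw [steps_mul]
    refine List.isChain_append.mpr ⟨ha, hb, ?_⟩
    rintro x hx y - ⟨rfl, -⟩
    exact last_ne_up a hx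
  have hs : ∀ a b : MPath X,
      (a * b).steps.IsChain (fun a b => ¬ (a = Step.up ∧ b = Step.down)) →
      a.steps.IsChain (fun a b => ¬ (a = Step.up ∧ b = Step.down)) ∧
      b.steps.IsChain (fun a b => ¬ (a = Step.up ∧ b = Step.down)) := by
    intro a b h
    rw [steps_mul] at h
    exact ⟨(List.isChain_append.mp h).1, (List.isChain_append.mp h).2.1⟩
  have hr : ∀ u : MPath X, u.raise.steps ≠ [] := fun u => by simp [steps_raise]
  refine pathProd_mem lam (pathL X) ?_ ?_ ?_ ?_
  · intro a u h
    have h1 : u.raise ∈ pathL X :=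
      (mem_pathL_iff _).mpr ⟨hr u, (hs _ _ ((mem_pathL_iff _).mp h).2).2⟩
    exact ⟨mem_of_raise_mem_pathL u h1, h1⟩
  · intro t b h
    have h1 : t.raise ∈ pathL X :=
      (mem_pathL_iff _).mpr ⟨hr t, (hs _ _ ((mem_pathL_iff _).mp h).2).1⟩
    exact ⟨mem_of_raise_mem_pathL t h1, h1⟩
  · intro a u t b z h h' hz
    have hz' := (mem_pathL_iff _).mp (raise_mem_pathL z hz)
    rw [mem_pathL_iff] at h h' ⊢
    refine ⟨by simp [steps_mul, steps_raise], hc _ _ (hc _ _ (hs _ _ h.2).1 hz'.2)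
      (hs _ _ h'.2).2⟩
  · intro m m' h h' _
    rw [mem_pathL_iff] at h h' ⊢
    exact ⟨by simp [steps_mul, h.1], hc _ _ h.2 h'.2⟩

theorem pathProd_mem_LV (lam : k) : ∀ m ∈ pathL X ∩ pathV X, ∀ m' ∈ pathL X ∩ pathV X,
    pathProd lam m m' ∈ kSpan k (pathL X ∩ pathV X) := by
  intro m hm m' hm'
  rw [kSpan, Finsupp.supported_inter]
  exact ⟨pathProd_mem_L lam m hm.1 m' hm'.1, pathProd_mem_V lam m hm.2 m' hm'.2⟩

theorem one_mem_pathV : (1 : MPath X) ∈ pathV X :=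
  (mem_pathV_iff _).mpr (by simp [steps_one])

theorem raise_mem_pathLV : ∀ m ∈ pathL X ∩ pathV X, MPath.raise m ∈ pathL X ∩ pathV X :=
  fun m hm => ⟨raise_mem_pathL m hm.1, raise_mem_pathV m hm.2⟩

/-- The product `⋄` on `kV(X)`. -/
noncomputable def mulV (k : Type u) [CommRing k] (X : Type v) (lam : k) :
    kSpan k (pathV X) →ₗ[k] kSpan k (pathV X) →ₗ[k] kSpan k (pathV X) :=
  bilinOn (pathProd lam) (pathProd_mem_V lam)

/-- The product `⋄` on `k(L(X) ∩ V(X))`, by the same formula on basis elements. -/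
noncomputable def mulLV (k : Type u) [CommRing k] (X : Type v) (lam : k) :
    kSpan k (pathL X ∩ pathV X) →ₗ[k] kSpan k (pathL X ∩ pathV X) →ₗ[k]
      kSpan k (pathL X ∩ pathV X) :=
  bilinOn (pathProd lam) (pathProd_mem_LV lam)

/-- The product on `k(L(X) ∩ V(X))` is the restriction of the one on `kV(X)`. -/
theorem coe_mulLV (k : Type u) [CommRing k] (lam : k) (a b : kSpan k (pathL X ∩ pathV X))
    (ha : (a : MPath X →₀ k) ∈ kSpan k (pathV X)) (hb : (b : MPath X →₀ k) ∈ kSpan k (pathV X)) :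
    (mulLV k X lam a b : MPath X →₀ k) = mulV k X lam ⟨a, ha⟩ ⟨b, hb⟩ := rfl

/-- The raising operator on `kV(X)`. -/
noncomputable def opV (k : Type u) [CommRing k] (X : Type v) :
    kSpan k (pathV X) →ₗ[k] kSpan k (pathV X) :=
  opOn MPath.raise raise_mem_pathV

/-- The raising operator on `k(L(X) ∩ V(X))`. -/
noncomputable def opLV (k : Type u) [CommRing k] (X : Type v) :
    kSpan k (pathL X ∩ pathV X) →ₗ[k] kSpan k (pathL X ∩ pathV X) :=
  opOn MPath.raise raise_mem_pathLV

end PathProduct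

/-! ### The characterizing properties of the products -/

/-- The properties that characterize `⋄` on `kY`, for a subset `Y` of a monoid `M` with an
operator `op`, a map `gen : X → M` and a set `indec` of indecomposable elements. -/
structure IsDiamond {k : Type u} [CommRing k] {M : Type v} [Monoid M] (op : M → M)
    (gen : X → M) (indec Y : Set M) (lam : k)
    (mul : kSpan k Y →ₗ[k] kSpan k Y →ₗ[k] kSpan k Y) : Prop where
  /-- `1 ∈ Y` is the identity. -/
  one : ∃ h : 1 ∈ Y, ∀ a, mul (bas k 1 h) a = a ∧ mul a (bas k 1 h) = a
  /-- `m ⋄ m' = m m'` for indecomposable `m, m' ≠ 1` one of which is a generator. -/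
  gen : ∀ m m' (hm : m ∈ Y) (hm' : m' ∈ Y), m ∈ indec → m' ∈ indec → m ≠ 1 → m' ≠ 1 →
    (m ∈ Set.range gen ∨ m' ∈ Set.range gen) →
    (mul (bas k m hm) (bas k m' hm') : M →₀ k) = Finsupp.single (m * m') 1
  /-- `P(u) ⋄ P(t) = P(u ⋄ P(t)) + P(P(u) ⋄ t) + lam P(u ⋄ t)`. -/
  op : ∀ u t (hu : u ∈ Y) (ht : t ∈ Y) (hu' : op u ∈ Y) (ht' : op t ∈ Y),
    (mul (bas k (op u) hu') (bas k (op t) ht') : M →₀ k) =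
      Finsupp.mapDomain op (mul (bas k u hu) (bas k (op t) ht') +
        mul (bas k (op u) hu') (bas k t ht) + lam • mul (bas k u hu) (bas k t ht) : kSpan k Y)
  /-- `(a p) ⋄ (q b) = a (p ⋄ q) b` for indecomposable `p, q ≠ 1`. -/
  decomp : ∀ a p q b (hp : p ∈ Y) (hq : q ∈ Y) (hap : a * p ∈ Y) (hqb : q * b ∈ Y),
    p ∈ indec → q ∈ indec → p ≠ 1 → q ≠ 1 →
    (mul (bas k (a * p) hap) (bas k (q * b) hqb) : M →₀ k) =
      Finsupp.mapDomain (fun z => a * z * b) (mul (bas k p hp) (bas k q hq) : kSpan k Y)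

/-! ### Rota--Baxter algebras -/

section RotaBaxter

variable {k : Type u} [CommRing k]

/-- `P(x)P(y) = P(xP(y)) + P(P(x)y) + lam P(xy)`. -/
def IsRotaBaxterOperator {A : Type w} [AddCommMonoid A] [Module k A] (lam : k)
    (mul : A →ₗ[k] A →ₗ[k] A) (P : A →ₗ[k] A) : Prop :=
  ∀ x y, mul (P x) (P y) = P (mul x (P y)) + P (mul (P x) y) + lam • P (mul x y)

/-- A `k`-module with this bilinear product and this operator is a nonunitary Rota--Baxter
algebra of weight `lam`. -/
structure IsNonunitaryRBAlgebra {A : Type w} [AddCommMonoid A] [Module k A] (lam : k)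
    (mul : A →ₗ[k] A →ₗ[k] A) (P : A →ₗ[k] A) : Prop where
  assoc : ∀ a b c, mul (mul a b) c = mul a (mul b c)
  rb : IsRotaBaxterOperator lam mul P

/-- A `k`-module with this bilinear product, identity and operator is a (unitary)
Rota--Baxter algebra of weight `lam`. -/
structure IsRBAlgebra {A : Type w} [AddCommMonoid A] [Module k A] (lam : k)
    (mul : A →ₗ[k] A →ₗ[k] A) (one : A) (P : A →ₗ[k] A) : Prop
    extends IsNonunitaryRBAlgebra lam mul P where
  one_mul : ∀ a, mul one a = a
  mul_one : ∀ a, mul a one = a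

/-- `(A, mul, one, P)` with `j : X → A` is the free Rota--Baxter algebra of weight `lam` on
the set `X`. -/
structure IsFreeRBAlgebra {A : Type max u v} [AddCommMonoid A] [Module k A] (lam : k)
    (mul : A →ₗ[k] A →ₗ[k] A) (one : A) (P : A →ₗ[k] A) (j : X → A) : Prop where
  isRBAlgebra : IsRBAlgebra lam mul one P
  lift : ∀ (B : Type w) [Ring B] [Algebra k B] (Q : B →ₗ[k] B),
    IsRotaBaxterOperator lam (LinearMap.mul k B) Q → ∀ f : X → B,
    ∃! F : A →ₗ[k] B, F one = 1 ∧ (∀ a b, F (mul a b) = F a * F b) ∧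
      (∀ a, F (P a) = Q (F a)) ∧ ∀ x, F (j x) = f x

/-- `(A, mul, P)` with `j : X → A` is the free nonunitary Rota--Baxter algebra of weight
`lam` on the set `X`. -/
structure IsFreeNonunitaryRBAlgebra {A : Type max u v} [AddCommMonoid A] [Module k A]
    (lam : k) (mul : A →ₗ[k] A →ₗ[k] A) (P : A →ₗ[k] A) (j : X → A) : Prop where
  isRBAlgebra : IsNonunitaryRBAlgebra lam mul P
  lift : ∀ (B : Type w) [NonUnitalRing B] [Module k B] [IsScalarTower k B B]
    [SMulCommClass k B B] (Q : B →ₗ[k] B),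
    IsRotaBaxterOperator lam (LinearMap.mul k B) Q → ∀ f : X → B,
    ∃! F : A →ₗ[k] B, (∀ a b, F (mul a b) = F a * F b) ∧
      (∀ a, F (P a) = Q (F a)) ∧ ∀ x, F (j x) = f x

end RotaBaxter

end RotaBaxterWords

open RotaBaxterWords

universe u v w

/-!
The proof treats words and paths together. Call `gen x` and `op u` the letters of a monoid `M` with
an operator `op` and a map `gen : X → M`. Bracketed words and Motzkin paths both have the property
that every element other than `1` begins and ends with a letter (`IsLetterGenerated`), and both
products obey the same rules (`IsDiamondRule`) on all of `kM`, before any restriction to a subset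
of `M`. From these two facts alone follow

* the characterization of the product (`IsDiamondRule.isDiamond_iff`): its properties reduce a
  product to smaller ones;
* associativity (`IsDiamondRule.assoc`): if the middle factor has two or more letters, the two
  multiplications do not interfere, and if it is a single letter the only case with content is that
  of `(a op(u), op(v), op(w) b)`, which follows by induction on the size from the Rota--Baxter
  identity;
* that a homomorphism of operated monoids over `X` respects the products (`IsDiamondRule.map`), and
  that one into an algebra with a Rota--Baxter operator extends to an algebra homomorphism
  (`IsDiamondRule.linearCombination_mul`).

For paths the rules require that a raised first or last factor of a path is unique
(`raise_mul_inj`, `mul_raise_inj`). The same uniqueness makes `toPath` a bijection from all words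
to all paths. Comparing letters, it carries Rota--Baxter words onto valley-free paths and
nonunitary words onto peak-free paths, which gives the isomorphisms.

For freeness, evaluation of words gives the homomorphism. It is unique because a Rota--Baxter word
has no two consecutive brackets and so is the diamond product of its letters (`rbHom_ext`).
-/

namespace RotaBaxterWords

/-! ### Diamond products on an operated monoid -/

section Diamond

variable {k : Type u} [CommRing k] {M : Type v} {X : Type v}

theorem bilin_single (f : M → M → (M →₀ k)) (m m' : M) (c c' : k) :
    bilin f (Finsupp.single m c) (Finsupp.single m' c') = c • c' • f m m' := by
  simp [bilin]

theorem bilin_single_one (f : M → M → (M →₀ k)) (m m' : M) :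
    bilin f (Finsupp.single m 1) (Finsupp.single m' 1) = f m m' := by
  simp [bilin_single]

variable [Monoid M]

/-- The letters of a monoid `M` with an operator `op` and a map `gen : X → M`: the elements
`gen x` and `op u`. -/
def IsLetter (op : M → M) (gen : X → M) (p : M) : Prop :=
  p ∈ Set.range gen ∨ p ∈ Set.range op

/-- Every element other than `1` has a first and a last letter, and `size` is an additive
length, positive on generators, that `op` increases. Uniqueness of the factorization is not part of this notion. -/
structure IsLetterGenerated (op : M → M) (gen : X → M) (size : M → ℕ) : Prop where
  left : ∀ m, m = 1 ∨ ∃ p b, IsLetter op gen p ∧ m = p * b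
  right : ∀ m, m = 1 ∨ ∃ a p, IsLetter op gen p ∧ m = a * p
  size_mul : ∀ a b, size (a * b) = size a + size b
  size_gen : ∀ x, 0 < size (gen x)
  size_op : ∀ u, size u < size (op u)

/-- The rules of the diamond product as a function `f : M → M → kM` on all of `M`: two letters
that meet and are both values of `op` are multiplied by the Rota--Baxter identity, and in all
other cases the product is that of the monoid. -/
structure IsDiamondRule (op : M → M) (gen : X → M) (lam : k) (f : M → M → (M →₀ k)) : Prop where
  one_left : ∀ m, f 1 m = Finsupp.single m 1
  one_right : ∀ m, f m 1 = Finsupp.single m 1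
  gen_left : ∀ a x m, f (a * gen x) m = Finsupp.single (a * gen x * m) 1
  gen_right : ∀ m x b, f m (gen x * b) = Finsupp.single (m * (gen x * b)) 1
  op_op : ∀ a u t b, f (a * op u) (op t * b) =
    Finsupp.mapDomain (fun z => a * op z * b) (f u (op t) + f (op u) t + lam • f u t)

variable {op : M → M} {gen : X → M} {size : M → ℕ} {lam : k} {f : M → M → (M →₀ k)}

theorem IsLetterGenerated.induction (hM : IsLetterGenerated op gen size) {C : M → Prop}
    (one : C 1) (gen_mul : ∀ x b, C b → C (gen x * b))
    (op_mul : ∀ u b, C u → C b → C (op u * b)) (m : M) : C m := by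
  induction hn : size m using Nat.strong_induction_on generalizing m with
  | _ n ih =>
  subst hn
  rcases hM.left m with rfl | ⟨p, b, ⟨x, rfl⟩ | ⟨u, rfl⟩, rfl⟩
  · exact one
  · have := hM.size_gen x
    rw [hM.size_mul] at ih
    exact gen_mul x b (ih _ (by omega) b rfl)
  · have := hM.size_op u
    rw [hM.size_mul] at ih
    exact op_mul u b (ih _ (by omega) u rfl) (ih _ (by omega) b rfl)

/-- Only the first letter of the right factor takes part in the product. -/
theorem IsDiamondRule.apply_letter_mul (hf : IsDiamondRule op gen lam f)
    (hM : IsLetterGenerated op gen size) {p : M} (hp : IsLetter op gen p) (m c : M) :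
    f m (p * c) = Finsupp.mapDomain (fun z => z * c) (f m p) := by
  rcases hp with ⟨x, rfl⟩ | ⟨v, rfl⟩
  · have := hf.gen_right m x 1
    rw [mul_one] at this
    simp [hf.gen_right, this, Finsupp.mapDomain_single, mul_assoc]
  · rcases hM.right m with rfl | ⟨a, p, ⟨x, rfl⟩ | ⟨u, rfl⟩, rfl⟩
    · simp [hf.one_left, Finsupp.mapDomain_single]
    · simp [hf.gen_left, Finsupp.mapDomain_single, mul_assoc]
    · have := hf.op_op a u v 1
      rw [mul_one] at this
      rw [hf.op_op, this, ← Finsupp.mapDomain_comp]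
      simp [Function.comp_def]

/-- Only the last letter of the left factor takes part in the product. -/
theorem IsDiamondRule.apply_mul_letter (hf : IsDiamondRule op gen lam f)
    (hM : IsLetterGenerated op gen size) {p : M} (hp : IsLetter op gen p) (c m : M) :
    f (c * p) m = Finsupp.mapDomain (fun z => c * z) (f p m) := by
  rcases hp with ⟨x, rfl⟩ | ⟨v, rfl⟩
  · have := hf.gen_left 1 x m
    rw [one_mul] at this
    simp [hf.gen_left, this, Finsupp.mapDomain_single, mul_assoc]
  · rcases hM.left m with rfl | ⟨p, b, ⟨x, rfl⟩ | ⟨u, rfl⟩, rfl⟩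
    · simp [hf.one_right, Finsupp.mapDomain_single]
    · simp [hf.gen_right, Finsupp.mapDomain_single, mul_assoc]
    · have := hf.op_op 1 v u b
      rw [one_mul] at this
      rw [hf.op_op, this, ← Finsupp.mapDomain_comp]
      simp [Function.comp_def, mul_assoc]

/-- The Rota--Baxter rule, extended bilinearly. -/
theorem IsDiamondRule.bilin_op_op (hf : IsDiamondRule op gen lam f) (a b : M) (y z : M →₀ k) :
    bilin f (Finsupp.mapDomain (fun u => a * op u) y) (Finsupp.mapDomain (fun t => op t * b) z) =
      Finsupp.mapDomain (fun m => a * op m * b) (bilin f y (Finsupp.mapDomain op z) +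
        bilin f (Finsupp.mapDomain op y) z + lam • bilin f y z) := by
  induction y using Finsupp.induction_linear with
  | zero => simp
  | add y y' h h' =>
    simp only [Finsupp.mapDomain_add, map_add, LinearMap.add_apply, h, h', smul_add]
    abel
  | single u c =>
    induction z using Finsupp.induction_linear with
    | zero => simp
    | add y y' h h' =>
      simp only [Finsupp.mapDomain_add, map_add, h, h', smul_add]
      abel
    | single t d =>
      simp only [Finsupp.mapDomain_single, bilin_single, hf.op_op]
      simp only [← Finsupp.mapDomain_smul, smul_add, smul_comm lam]

theorem bilin_single_product (d : M) (c : k) (y : M) (z : M →₀ k) :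
    bilin (fun m m' => Finsupp.single (m * d * m') (1 : k)) (Finsupp.single y c) z =
      c • Finsupp.mapDomain (fun m => y * d * m) z := by
  induction z using Finsupp.induction_linear with
  | zero => simp
  | add z z' h h' => simp only [map_add, h, h', Finsupp.mapDomain_add, smul_add]
  | single m e => simp [bilin_single, Finsupp.mapDomain_single]

theorem bilin_product_single (d : M) (c : k) (y : M) (z : M →₀ k) :
    bilin (fun m m' => Finsupp.single (m * d * m') (1 : k)) z (Finsupp.single y c) =
      c • Finsupp.mapDomain (fun m => m * (d * y)) z := by
  induction z using Finsupp.induction_linear with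
  | zero => simp
  | add z z' h h' =>
    simp only [map_add, LinearMap.add_apply, h, h', Finsupp.mapDomain_add, smul_add]
  | single m e => simp [bilin_single, Finsupp.mapDomain_single, mul_assoc, mul_comm]

/-- With `z = u ⋄ p` for a letter `p`, the left side is `(u ⋄ p d q) ⋄ m`. The two products act at
the two ends of `d`, so it is `∑ y d y'` over the terms `y` of `z` and `y'` of `q ⋄ m`. -/
theorem IsDiamondRule.bilin_mapDomain_mul_letter (hf : IsDiamondRule op gen lam f)
    (hM : IsLetterGenerated op gen size) {q : M} (hq : IsLetter op gen q) (d m : M)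
    (z : M →₀ k) :
    bilin f (Finsupp.mapDomain (fun y => y * (d * q)) z) (Finsupp.single m 1) =
      bilin (fun m m' => Finsupp.single (m * d * m') (1 : k)) z (f q m) := by
  induction z using Finsupp.induction_linear with
  | zero => simp
  | add z z' h h' => simp only [Finsupp.mapDomain_add, map_add, LinearMap.add_apply, h, h']
  | single y c =>
    rw [Finsupp.mapDomain_single, bilin_single, one_smul, bilin_single_product, ← mul_assoc,
      hf.apply_mul_letter hM hq]

theorem IsDiamondRule.bilin_mapDomain_letter_mul (hf : IsDiamondRule op gen lam f)
    (hM : IsLetterGenerated op gen size) {p : M} (hp : IsLetter op gen p) (m d : M)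
    (z : M →₀ k) :
    bilin f (Finsupp.single m 1) (Finsupp.mapDomain (fun y => p * d * y) z) =
      bilin (fun m m' => Finsupp.single (m * d * m') (1 : k)) (f m p) z := by
  induction z using Finsupp.induction_linear with
  | zero => simp
  | add z z' h h' => simp only [Finsupp.mapDomain_add, map_add, h, h']
  | single y c =>
    rw [Finsupp.mapDomain_single, bilin_single, one_smul, bilin_product_single, mul_assoc,
      hf.apply_letter_mul hM hp]

theorem IsDiamondRule.bilin_gen_left (hf : IsDiamondRule op gen lam f) (a : M) (x : X)
    (z : M →₀ k) : bilin f (Finsupp.single (a * gen x) 1) z =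
      Finsupp.mapDomain (fun m => a * gen x * m) z := by
  induction z using Finsupp.induction_linear with
  | zero => simp
  | add z z' h h' => simp only [Finsupp.mapDomain_add, map_add, h, h']
  | single y c => simp [bilin_single, hf.gen_left, Finsupp.mapDomain_single]

theorem IsDiamondRule.bilin_gen_right (hf : IsDiamondRule op gen lam f) (b : M) (x : X)
    (z : M →₀ k) : bilin f z (Finsupp.single (gen x * b) 1) =
      Finsupp.mapDomain (fun m => m * (gen x * b)) z := by
  induction z using Finsupp.induction_linear with
  | zero => simp
  | add z z' h h' => simp only [Finsupp.mapDomain_add, map_add, LinearMap.add_apply, h, h']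
  | single y c => simp [bilin_single, hf.gen_right, Finsupp.mapDomain_single]

theorem IsDiamondRule.bilin_one_left (hf : IsDiamondRule op gen lam f) (z : M →₀ k) :
    bilin f (Finsupp.single 1 1) z = z := by
  induction z using Finsupp.induction_linear with
  | zero => simp
  | add z z' h h' => simp only [map_add, h, h']
  | single y c => simp [bilin_single, hf.one_left]

theorem IsDiamondRule.bilin_one_right (hf : IsDiamondRule op gen lam f) (z : M →₀ k) :
    bilin f z (Finsupp.single 1 1) = z := by
  induction z using Finsupp.induction_linear with
  | zero => simp
  | add z z' h h' => simp only [map_add, LinearMap.add_apply, h, h']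
  | single y c => simp [bilin_single, hf.one_right]

/-- The inductive step of associativity, where three values of `op` meet: each side expands into
the same seven triple products, in each of which at least one `op` has been removed. -/
theorem IsDiamondRule.assoc_op_op_op (hf : IsDiamondRule op gen lam f) (a b u v w : M)
    (hM : IsLetterGenerated op gen size)
    (ih : ∀ u' v' w', size u' + size v' + size w' < size (op u) + size (op v) + size (op w) →
      bilin f (f u' v') (Finsupp.single w' 1) = bilin f (Finsupp.single u' 1) (f v' w')) :
    bilin f (f (a * op u) (op v)) (Finsupp.single (op w * b) 1) =
      bilin f (Finsupp.single (a * op u) 1) (f (op v) (op w * b)) := by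
  have e1 := hf.op_op a u v 1
  have e2 := hf.op_op 1 v w b
  have e3 := hf.op_op 1 u v 1
  have e4 := hf.op_op 1 v w 1
  simp only [mul_one, one_mul] at e1 e2 e3 e4
  have l := hf.bilin_op_op a b (f u (op v) + f (op u) v + lam • f u v) (Finsupp.single w 1)
  have r := hf.bilin_op_op a b (Finsupp.single u 1) (f v (op w) + f (op v) w + lam • f v w)
  rw [Finsupp.mapDomain_single] at l r
  rw [e1, e2, l, r]
  congr 1
  rw [← e3, ← e4]
  simp only [Finsupp.mapDomain_single, map_add, map_smul, LinearMap.add_apply,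
    LinearMap.smul_apply]
  have hu := hM.size_op u
  have hv := hM.size_op v
  have hw := hM.size_op w
  rw [ih u (op v) (op w) (by omega), ih (op u) v (op w) (by omega), ih u v (op w) (by omega),
    ih (op u) (op v) w (by omega), ih u (op v) w (by omega), ih (op u) v w (by omega),
    ih u v w (by omega)]
  simp only [smul_add]
  abel

theorem IsDiamondRule.assoc_basis (hf : IsDiamondRule op gen lam f)
    (hM : IsLetterGenerated op gen size) (u v w : M) :
    bilin f (f u v) (Finsupp.single w 1) = bilin f (Finsupp.single u 1) (f v w) := by
  induction hn : size u + size v + size w using Nat.strong_induction_on generalizing u v w with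
  | _ n ih =>
  subst hn
  rcases hM.left v with rfl | ⟨p, c, hp, rfl⟩
  · rw [hf.one_left, hf.one_right]
  rcases hM.right c with rfl | ⟨d, q, hq, rfl⟩
  swap
  -- The middle factor has at least two letters, so the two products do not interfere.
  · rw [hf.apply_letter_mul hM hp, hf.bilin_mapDomain_mul_letter hM hq, ← mul_assoc,
      hf.apply_mul_letter hM hq, hf.bilin_mapDomain_letter_mul hM hp]
  rw [mul_one] at ih ⊢
  rcases hM.right u with rfl | ⟨a, r, ⟨x, rfl⟩ | ⟨u, rfl⟩, rfl⟩
  · rw [hf.one_left, bilin_single_one, hf.bilin_one_left]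
  · rw [hf.gen_left, bilin_single_one, hf.bilin_gen_left, hf.apply_mul_letter hM hp]
  rcases hM.left w with rfl | ⟨r, b, ⟨x, rfl⟩ | ⟨w, rfl⟩, rfl⟩
  · rw [hf.one_right, bilin_single_one, hf.bilin_one_right]
  · rw [hf.gen_right, bilin_single_one, hf.bilin_gen_right, hf.apply_letter_mul hM hp]
  rcases hp with ⟨x, rfl⟩ | ⟨v, rfl⟩
  · have e1 := hf.gen_left 1 x (op w * b)
    have e2 := hf.gen_right (a * op u) x 1
    rw [one_mul] at e1
    rw [mul_one] at e2
    rw [e1, e2, bilin_single_one, bilin_single_one, hf.gen_left,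
      hf.gen_right, mul_assoc]
  · refine hf.assoc_op_op_op a b u v w hM fun u' v' w' h => ih _ ?_ _ _ _ rfl
    simp only [hM.size_mul]
    omega

theorem IsDiamondRule.assoc (hf : IsDiamondRule op gen lam f)
    (hM : IsLetterGenerated op gen size) (y z t : M →₀ k) :
    bilin f (bilin f y z) t = bilin f y (bilin f z t) := by
  induction y using Finsupp.induction_linear with
  | zero => simp
  | add y y' h h' => simp only [map_add, LinearMap.add_apply, h, h']
  | single u c =>
  induction z using Finsupp.induction_linear with
  | zero => simp
  | add y y' h h' => simp only [map_add, LinearMap.add_apply, h, h']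
  | single v d =>
  induction t using Finsupp.induction_linear with
  | zero => simp
  | add y y' h h' => simp only [map_add, h, h']
  | single w e =>
    have := hf.assoc_basis hM u v w
    rw [← bilin_single_one f u v, ← bilin_single_one f v w] at this
    rw [← mul_one c, ← mul_one d, ← mul_one e, ← smul_eq_mul c, ← smul_eq_mul d,
      ← smul_eq_mul e]
    simp only [← Finsupp.smul_single, map_smul, LinearMap.smul_apply, this]

end Diamond

/-! ### Diamond products on the span of a subset -/

section DiamondOn

variable {k : Type u} [CommRing k] {M : Type v} {X : Type v}

/-- Linear maps on `kY` that agree on `Y` are equal. -/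
theorem kSpan_hom_ext {Y : Set M} {N : Type w} [AddCommMonoid N] [Module k N]
    {F G : kSpan k Y →ₗ[k] N} (h : ∀ m hm, F (bas k m hm) = G (bas k m hm)) : F = G := by
  have key : F.comp (Finsupp.supportedEquivFinsupp Y).symm.toLinearMap =
      G.comp (Finsupp.supportedEquivFinsupp Y).symm.toLinearMap := by
    refine Finsupp.lhom_ext' fun m => LinearMap.ext_ring ?_
    have e : (Finsupp.supportedEquivFinsupp (R := k) (M := k) Y).symm (Finsupp.single m 1) =
        bas k m.1 m.2 := by
      rw [LinearEquiv.symm_apply_eq]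
      ext n
      exact (Finsupp.single_apply_left Subtype.val_injective _ _ _).symm
    simpa [e] using h m.1 m.2
  ext a
  simpa using LinearMap.congr_fun key (Finsupp.supportedEquivFinsupp Y a)

/-- The isomorphism `kY ≃ kZ` induced by a bijection `M ≃ N` that carries `Y` onto `Z`. -/
noncomputable def kSpanEquiv (k : Type u) [CommRing k] {N : Type v} {Y : Set M} {Z : Set N}
    (e : M ≃ N) (h : ∀ m, e m ∈ Z ↔ m ∈ Y) : kSpan k Y ≃ₗ[k] kSpan k Z :=
  LinearEquiv.ofLinearMap
    ((Finsupp.lmapDomain k k e).restrict fun _ ha => mapDomain_mem e (fun m => (h m).mpr) ha)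
    ((Finsupp.lmapDomain k k e.symm).restrict fun _ ha =>
      mapDomain_mem e.symm (fun n hn => (h _).mp (by rwa [e.apply_symm_apply])) ha)
    (LinearMap.ext fun a => Subtype.ext <| by
      change Finsupp.mapDomain e (Finsupp.mapDomain e.symm a.1) = a.1
      rw [← Finsupp.mapDomain_comp, e.self_comp_symm, Finsupp.mapDomain_id])
    (LinearMap.ext fun a => Subtype.ext <| by
      change Finsupp.mapDomain e.symm (Finsupp.mapDomain e a.1) = a.1
      rw [← Finsupp.mapDomain_comp, e.symm_comp_self, Finsupp.mapDomain_id])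

theorem coe_bas {Y : Set M} (m : M) (hm : m ∈ Y) :
    (bas k m hm : M →₀ k) = Finsupp.single m 1 := rfl

theorem coe_bilinOn {Y : Set M} {f : M → M → (M →₀ k)}
    (h : ∀ m ∈ Y, ∀ m' ∈ Y, f m m' ∈ kSpan k Y) (a b : kSpan k Y) :
    (bilinOn f h a b : M →₀ k) = bilin f a b := rfl

theorem coe_opOn {Y : Set M} {op : M → M} (h : ∀ m ∈ Y, op m ∈ Y) (a : kSpan k Y) :
    (opOn op h a : M →₀ k) = Finsupp.mapDomain op (a : M →₀ k) := rfl

theorem coe_bilinOn_bas {Y : Set M} {f : M → M → (M →₀ k)}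
    (h : ∀ m ∈ Y, ∀ m' ∈ Y, f m m' ∈ kSpan k Y) {m m' : M} (hm : m ∈ Y) (hm' : m' ∈ Y) :
    (bilinOn f h (bas k m hm) (bas k m' hm') : M →₀ k) = f m m' := by
  rw [coe_bilinOn, coe_bas, coe_bas, bilin_single_one]

theorem opOn_bas {Y : Set M} {op : M → M} (h : ∀ m ∈ Y, op m ∈ Y) {m : M} (hm : m ∈ Y) :
    opOn op h (bas k m hm) = bas k (op m) (h m hm) := by
  ext1
  rw [coe_opOn, coe_bas, Finsupp.mapDomain_single, coe_bas]

variable [Monoid M]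

/-- The set `Y` contains the first and the last letter of each of its elements, and `u` when it
contains `op u`. -/
structure IsLetterClosed (op : M → M) (gen : X → M) (Y : Set M) : Prop where
  left : ∀ p b, IsLetter op gen p → p * b ∈ Y → p ∈ Y
  right : ∀ a p, IsLetter op gen p → a * p ∈ Y → p ∈ Y
  of_op : ∀ u, op u ∈ Y → u ∈ Y

variable {op : M → M} {gen : X → M} {size : M → ℕ} {lam : k} {f : M → M → (M →₀ k)}
  {indec Y : Set M}

theorem IsDiamondRule.isDiamond (hf : IsDiamondRule op gen lam f) (h1 : 1 ∈ Y)
    (hY : ∀ m ∈ Y, ∀ m' ∈ Y, f m m' ∈ kSpan k Y)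
    (hindec : ∀ p ∈ indec, p ≠ 1 → IsLetter op gen p) :
    IsDiamond op gen indec Y lam (bilinOn f hY) where
  one := by
    refine ⟨h1, fun a => ⟨Subtype.ext ?_, Subtype.ext ?_⟩⟩
    · rw [coe_bilinOn, coe_bas, hf.bilin_one_left]
    · rw [coe_bilinOn, coe_bas, hf.bilin_one_right]
  gen := by
    rintro m m' hm hm' - - - - (⟨x, rfl⟩ | ⟨x, rfl⟩)
    · have := hf.gen_left 1 x m'
      rwa [one_mul, ← coe_bilinOn_bas hY hm hm'] at this
    · have := hf.gen_right m x 1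
      rwa [mul_one, ← coe_bilinOn_bas hY hm hm'] at this
  op := by
    intro u t hu ht hu' ht'
    have := hf.op_op 1 u t 1
    simp only [one_mul, mul_one] at this
    simp only [Submodule.coe_add, Submodule.coe_smul, coe_bilinOn_bas, this]
  decomp := by
    intro a p q b hp hq hap hqb hpi hqi hp1 hq1
    rw [coe_bilinOn_bas, coe_bilinOn_bas]
    rcases hindec p hpi hp1 with ⟨x, rfl⟩ | ⟨u, rfl⟩
    · have := hf.gen_left 1 x q
      rw [one_mul] at this
      simp [hf.gen_left, this, Finsupp.mapDomain_single, mul_assoc]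
    rcases hindec q hqi hq1 with ⟨x, rfl⟩ | ⟨t, rfl⟩
    · have := hf.gen_right (op u) x 1
      rw [mul_one] at this
      simp [hf.gen_right, this, Finsupp.mapDomain_single, mul_assoc]
    · have := hf.op_op 1 u t 1
      rw [one_mul, mul_one] at this
      rw [hf.op_op, this, ← Finsupp.mapDomain_comp]
      simp [Function.comp_def]

/-- The characterizing properties reduce the product of two basis elements to products of
smaller total size. -/
theorem IsDiamond.unique (hM : IsLetterGenerated op gen size) (hY : IsLetterClosed op gen Y)
    (hindec : ∀ p, IsLetter op gen p → p ∈ indec ∧ p ≠ 1)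
    {mul mul' : kSpan k Y →ₗ[k] kSpan k Y →ₗ[k] kSpan k Y}
    (h : IsDiamond op gen indec Y lam mul) (h' : IsDiamond op gen indec Y lam mul') :
    mul = mul' := by
  suffices H : ∀ m m' (hm : m ∈ Y) (hm' : m' ∈ Y),
      mul (bas k m hm) (bas k m' hm') = mul' (bas k m hm) (bas k m' hm') from
    kSpan_hom_ext fun m hm => kSpan_hom_ext fun m' hm' => H m m' hm hm'
  intro m m' hm hm'
  induction hn : size m + size m' using Nat.strong_induction_on generalizing m m' with
  | _ n ih =>
  subst hn
  rcases hM.right m with rfl | ⟨a, p, hp, rfl⟩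
  · obtain ⟨h1, e⟩ := h.one
    obtain ⟨h1', e'⟩ := h'.one
    rw [(e _).1, (e' _).1]
  rcases hM.left m' with rfl | ⟨q, b, hq, rfl⟩
  · obtain ⟨h1, e⟩ := h.one
    obtain ⟨h1', e'⟩ := h'.one
    rw [(e _).2, (e' _).2]
  have hpY := hY.right a p hp hm
  have hqY := hY.left q b hq hm'
  obtain ⟨hpi, hp1⟩ := hindec p hp
  obtain ⟨hqi, hq1⟩ := hindec q hq
  ext1
  rw [h.decomp a p q b hpY hqY hm hm' hpi hqi hp1 hq1,
    h'.decomp a p q b hpY hqY hm hm' hpi hqi hp1 hq1]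
  congr 1
  by_cases hg : p ∈ Set.range gen ∨ q ∈ Set.range gen
  · rw [h.gen p q hpY hqY hpi hqi hp1 hq1 hg, h'.gen p q hpY hqY hpi hqi hp1 hq1 hg]
  · push Not at hg
    obtain ⟨u, rfl⟩ := hp.resolve_left hg.1
    obtain ⟨t, rfl⟩ := hq.resolve_left hg.2
    have hu := hY.of_op u hpY
    have ht := hY.of_op t hqY
    have su := hM.size_op u
    have st := hM.size_op t
    simp only [hM.size_mul] at ih
    rw [h.op u t hu ht hpY hqY, h'.op u t hu ht hpY hqY,
      ih _ (by omega) u (op t) hu hqY rfl, ih _ (by omega) (op u) t hpY ht rfl,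
      ih _ (by omega) u t hu ht rfl]

theorem IsDiamondRule.isDiamond_iff (hf : IsDiamondRule op gen lam f)
    (hM : IsLetterGenerated op gen size) (hY : IsLetterClosed op gen Y) (h1 : 1 ∈ Y)
    (hfY : ∀ m ∈ Y, ∀ m' ∈ Y, f m m' ∈ kSpan k Y)
    (hindec : ∀ p, IsLetter op gen p ↔ p ∈ indec ∧ p ≠ 1)
    (mul : kSpan k Y →ₗ[k] kSpan k Y →ₗ[k] kSpan k Y) :
    IsDiamond op gen indec Y lam mul ↔ mul = bilinOn f hfY := by
  have h := hf.isDiamond h1 hfY fun p hp hp1 => (hindec p).mpr ⟨hp, hp1⟩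
  exact ⟨fun h' => IsDiamond.unique hM hY (fun p => (hindec p).mp) h' h, fun e => e ▸ h⟩

theorem IsDiamondRule.isNonunitaryRBAlgebra (hf : IsDiamondRule op gen lam f)
    (hM : IsLetterGenerated op gen size) (hfY : ∀ m ∈ Y, ∀ m' ∈ Y, f m m' ∈ kSpan k Y)
    (hop : ∀ m ∈ Y, op m ∈ Y) :
    IsNonunitaryRBAlgebra lam (bilinOn f hfY) (opOn op hop) where
  assoc a b c := Subtype.ext (hf.assoc hM a.1 b.1 c.1)
  rb y z := by
    ext1
    have := hf.bilin_op_op 1 1 y.1 z.1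
    simp only [one_mul, mul_one] at this
    simp only [coe_bilinOn, coe_opOn, Submodule.coe_add, Submodule.coe_smul, this,
      Finsupp.mapDomain_add, Finsupp.mapDomain_smul]

theorem IsDiamondRule.isRBAlgebra (hf : IsDiamondRule op gen lam f)
    (hM : IsLetterGenerated op gen size) (h1 : 1 ∈ Y)
    (hfY : ∀ m ∈ Y, ∀ m' ∈ Y, f m m' ∈ kSpan k Y) (hop : ∀ m ∈ Y, op m ∈ Y) :
    IsRBAlgebra lam (bilinOn f hfY) (bas k 1 h1) (opOn op hop) where
  toIsNonunitaryRBAlgebra := hf.isNonunitaryRBAlgebra hM hfY hop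
  one_mul a := Subtype.ext (hf.bilin_one_left a.1)
  mul_one a := Subtype.ext (hf.bilin_one_right a.1)

/-- A homomorphism of operated monoids over `X` respects the diamond products. -/
theorem IsDiamondRule.map {N : Type v} [Monoid N] {op' : N → N} {gen' : X → N}
    {g : N → N → (N →₀ k)} (hf : IsDiamondRule op gen lam f) (hg : IsDiamondRule op' gen' lam g)
    (hM : IsLetterGenerated op gen size) (φ : M →* N) (hop : ∀ m, φ (op m) = op' (φ m))
    (hgen : ∀ x, φ (gen x) = gen' x) (m m' : M) :
    g (φ m) (φ m') = Finsupp.mapDomain φ (f m m') := by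
  induction hn : size m + size m' using Nat.strong_induction_on generalizing m m' with
  | _ n ih =>
  subst hn
  rcases hM.right m with rfl | ⟨a, p, ⟨x, rfl⟩ | ⟨u, rfl⟩, rfl⟩
  · simp [hf.one_left, hg.one_left, Finsupp.mapDomain_single]
  · simp [hf.gen_left, hg.gen_left, hgen, Finsupp.mapDomain_single]
  rcases hM.left m' with rfl | ⟨q, b, ⟨x, rfl⟩ | ⟨t, rfl⟩, rfl⟩
  · simp [hf.one_right, hg.one_right, Finsupp.mapDomain_single]
  · simp [hf.gen_right, hg.gen_right, hgen, Finsupp.mapDomain_single]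
  have su := hM.size_op u
  have st := hM.size_op t
  simp only [hM.size_mul] at ih
  rw [map_mul, map_mul, hop, hop, hg.op_op, hf.op_op, ← Finsupp.mapDomain_comp, ← hop, ← hop,
    ih _ (by omega) u (op t) rfl, ih _ (by omega) (op u) t rfl, ih _ (by omega) u t rfl,
    ← Finsupp.mapDomain_smul, ← Finsupp.mapDomain_add, ← Finsupp.mapDomain_add,
    ← Finsupp.mapDomain_comp]
  simp [Function.comp_def, hop]

theorem IsDiamondRule.mapDomain_bilin {N : Type v} [Monoid N] {op' : N → N} {gen' : X → N}
    {g : N → N → (N →₀ k)} (hf : IsDiamondRule op gen lam f) (hg : IsDiamondRule op' gen' lam g)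
    (hM : IsLetterGenerated op gen size) (φ : M →* N) (hop : ∀ m, φ (op m) = op' (φ m))
    (hgen : ∀ x, φ (gen x) = gen' x) (y z : M →₀ k) :
    Finsupp.mapDomain φ (bilin f y z) =
      bilin g (Finsupp.mapDomain φ y) (Finsupp.mapDomain φ z) := by
  induction y using Finsupp.induction_linear with
  | zero => simp
  | add y y' h h' => simp only [map_add, LinearMap.add_apply, Finsupp.mapDomain_add, h, h']
  | single m c =>
  induction z using Finsupp.induction_linear with
  | zero => simp
  | add y y' h h' => simp only [map_add, Finsupp.mapDomain_add, h, h']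
  | single m' c' =>
    simp only [bilin_single, Finsupp.mapDomain_single, Finsupp.mapDomain_smul,
      hf.map hg hM φ hop hgen]

/-- Linear extension of a homomorphism `e` of operated monoids to an algebra is multiplicative
for the diamond product, if the operator of the algebra satisfies the Rota--Baxter identity on
the image of `Y`. -/
theorem IsDiamondRule.linearCombination_mul {B : Type*} [Ring B] [Algebra k B]
    (hf : IsDiamondRule op gen lam f) (hM : IsLetterGenerated op gen size)
    (hY : IsLetterClosed op gen Y) (e : M →* B) (Q : B →ₗ[k] B)
    (he : ∀ u ∈ Y, e (op u) = Q (e u))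
    (hQ : ∀ u ∈ Y, ∀ t ∈ Y, Q (e u) * Q (e t) =
      Q (e u * Q (e t)) + Q (Q (e u) * e t) + lam • Q (e u * e t))
    (hfY : ∀ m ∈ Y, ∀ m' ∈ Y, f m m' ∈ kSpan k Y) {m m' : M} (hm : m ∈ Y) (hm' : m' ∈ Y) :
    Finsupp.linearCombination k e (f m m') = e m * e m' := by
  have key : ∀ a b : M, ∀ z ∈ kSpan k Y,
      Finsupp.linearCombination k e (Finsupp.mapDomain (fun z => a * op z * b) z) =
        e a * Q (Finsupp.linearCombination k e z) * e b := by
    intro a b z hz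
    have : (Finsupp.linearCombination k e ∘ₗ Finsupp.lmapDomain k k fun z => a * op z * b).comp
          (kSpan k Y).subtype =
        (LinearMap.mulRight k (e b) ∘ₗ LinearMap.mulLeft k (e a) ∘ₗ Q ∘ₗ
          Finsupp.linearCombination k e).comp (kSpan k Y).subtype := by
      refine kSpan_hom_ext fun m hm => ?_
      simp [coe_bas, Finsupp.mapDomain_single, he m hm]
    exact LinearMap.congr_fun this ⟨z, hz⟩
  induction hn : size m + size m' using Nat.strong_induction_on generalizing m m' with
  | _ n ih =>
  subst hn
  rcases hM.right m with rfl | ⟨a, p, ⟨x, rfl⟩ | ⟨u, rfl⟩, rfl⟩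
  · simp [hf.one_left]
  · simp [hf.gen_left]
  rcases hM.left m' with rfl | ⟨q, b, ⟨x, rfl⟩ | ⟨t, rfl⟩, rfl⟩
  · simp [hf.one_right]
  · simp [hf.gen_right]
  have hu' := hY.right _ _ (Or.inr ⟨u, rfl⟩) hm
  have ht' := hY.left _ _ (Or.inr ⟨t, rfl⟩) hm'
  have hu := hY.of_op u hu'
  have ht := hY.of_op t ht'
  have su := hM.size_op u
  have st := hM.size_op t
  simp only [hM.size_mul] at ih
  rw [hf.op_op, key _ _ _ (add_mem (add_mem (hfY _ hu _ ht') (hfY _ hu' _ ht))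
    (Submodule.smul_mem _ _ (hfY _ hu _ ht)))]
  simp only [map_add, map_smul]
  rw [ih _ (by omega) hu ht' rfl, ih _ (by omega) hu' ht rfl, ih _ (by omega) hu ht rfl,
    map_mul e a, map_mul e (op t), he u hu, he t ht, ← hQ u hu t ht]
  simp only [mul_assoc]

end DiamondOn

/-! ### Factorization of Motzkin paths -/

section Paths

variable {X : Type v}

theorem MPath.ext_steps {m m' : MPath X} (h : m.steps = m'.steps) : m = m' :=
  Subtype.ext (FreeMonoid.toList.injective h)

theorem steps_level (x : X) : (MPath.level x).steps = [Step.level x] := rfl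

theorem raise_ne_one (u : MPath X) : u.raise ≠ 1 := fun h => by
  simpa [steps_raise, steps_one] using congrArg MPath.steps h

theorem level_ne_one (x : X) : MPath.level x ≠ 1 := fun h => by
  simpa [steps_level, steps_one] using congrArg MPath.steps h

theorem exists_level_mul (m : MPath X) (x : X) (l : List (Step X))
    (hm : m.steps = Step.level x :: l) : ∃ b : MPath X, m = MPath.level x * b := by
  have hM : IsMotzkin (Step.level x :: l) := hm ▸ m.2
  refine ⟨⟨FreeMonoid.ofList l, fun j => ?_, ?_⟩, MPath.ext_steps ?_⟩
  · simpa [height, Step.rise] using hM.1 (j + 1)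
  · simpa [height, Step.rise] using hM.2
  · rw [steps_mul, steps_level, hm]
    rfl

theorem exists_mul_level (m : MPath X) (x : X) (l : List (Step X))
    (hm : m.steps = l ++ [Step.level x]) : ∃ a : MPath X, m = a * MPath.level x := by
  have hM : IsMotzkin (l ++ [Step.level x]) := hm ▸ m.2
  refine ⟨⟨FreeMonoid.ofList l, fun j => ?_, ?_⟩, MPath.ext_steps ?_⟩
  · have := hM.1 (min j l.length)
    rw [List.take_append_of_le_length (by omega)] at this
    rcases le_total j l.length with h | h
    · simpa [h] using this
    · simpa [h, List.take_of_length_le h] using this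
  · simpa [height, Step.rise] using hM.2
  · rw [steps_mul, steps_level, hm]
    rfl

theorem motzkin_isLetterGenerated :
    IsLetterGenerated (X := X) MPath.raise MPath.level (fun m => m.steps.length) where
  left m := by
    rcases hs : m.steps with _ | ⟨s, l⟩
    · exact Or.inl (MPath.ext_steps (hs.trans steps_one.symm))
    · right
      rcases s with _ | _ | x
      · obtain ⟨t, b, e⟩ := exists_raise_mul m l hs
        exact ⟨_, b, Or.inr ⟨t, rfl⟩, e⟩
      · exact absurd (by simp [hs]) (head_ne_down m)
      · obtain ⟨b, e⟩ := exists_level_mul m x l hs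
        exact ⟨_, b, Or.inl ⟨x, rfl⟩, e⟩
  right m := by
    rcases List.eq_nil_or_concat m.steps with hs | ⟨l, s, hs⟩
    · exact Or.inl (MPath.ext_steps (hs.trans steps_one.symm))
    · right
      rw [List.concat_eq_append] at hs
      rcases s with _ | _ | x
      · exact absurd (by simp [hs]) (last_ne_up m)
      · obtain ⟨a, u, e⟩ := exists_mul_raise m l hs
        exact ⟨a, _, Or.inr ⟨u, rfl⟩, e⟩
      · obtain ⟨a, e⟩ := exists_mul_level m x l hs
        exact ⟨a, _, Or.inl ⟨x, rfl⟩, e⟩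
  size_mul a b := by simp [steps_mul]
  size_gen x := by simp [steps_level]
  size_op u := by
    simp only [steps_raise, List.length_cons, List.length_append]
    omega

/-- A raised first factor ends where the path first returns to the axis, so it is unique. -/
theorem raise_mul_inj {t t' b b' : MPath X} (h : t.raise * b = t'.raise * b') :
    t = t' ∧ b = b' := by
  -- A path followed by a down step goes below the axis, so it is not a prefix of a path.
  have key : ∀ (m m' : MPath X) (c : List (Step X)), m'.steps ≠ m.steps ++ Step.down :: c := by
    intro m m' c e
    have := m'.2.1 (m.steps.length + 1)
    change 0 ≤ height (m'.steps.take _) at this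
    have h0 : height m.steps = 0 := m.2.2
    rw [e, List.take_length_add_append, height_append, h0] at this
    simp [height, Step.rise] at this
  have hs := congrArg MPath.steps h
  simp only [steps_mul, steps_raise, List.cons_append, List.append_assoc, List.nil_append,
    List.cons.injEq, true_and] at hs
  rcases List.append_eq_append_iff.mp hs with ⟨c, h1, h2⟩ | ⟨c, h1, h2⟩ <;>
    rcases c with _ | ⟨s, c⟩ <;> simp only [List.append_nil, List.nil_append, List.cons_append,
      List.cons.injEq] at h1 h2
  · exact ⟨MPath.ext_steps h1.symm, MPath.ext_steps h2.2⟩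
  · exact (key t t' c (by rw [h1, h2.1])).elim
  · exact ⟨MPath.ext_steps h1, MPath.ext_steps h2.2.symm⟩
  · exact (key t' t c (by rw [h1, h2.1])).elim

theorem mul_raise_inj {a a' u u' : MPath X} (h : a * u.raise = a' * u'.raise) :
    a = a' ∧ u = u' := by
  -- An up step followed by a path is not a suffix of a path.
  have key : ∀ (m m' : MPath X) (c : List (Step X)), m'.steps ≠ c ++ Step.up :: m.steps := by
    intro m m' c e
    have h1 := m'.2.1 c.length
    have h2 : height m'.steps = 0 := m'.2.2
    have h0 : height m.steps = 0 := m.2.2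
    change 0 ≤ height (m'.steps.take _) at h1
    rw [e, List.take_left] at h1
    rw [e, height_append] at h2
    simp only [height, List.map_cons, List.sum_cons, Step.rise] at h0 h1 h2
    omega
  have hs := congrArg MPath.steps h
  simp only [steps_mul, steps_raise] at hs
  rw [← List.cons_append, ← List.cons_append, ← List.append_assoc, ← List.append_assoc,
    List.append_left_inj] at hs
  rcases List.append_eq_append_iff.mp hs with ⟨c, h1, h2⟩ | ⟨c, h1, h2⟩ <;>
    rcases c with _ | ⟨s, c⟩ <;> simp only [List.append_nil, List.nil_append, List.cons_append,
      List.cons.injEq] at h1 h2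
  · exact ⟨MPath.ext_steps h1.symm, MPath.ext_steps h2.2⟩
  · exact (key u' u c h2.2).elim
  · exact ⟨MPath.ext_steps h1, MPath.ext_steps h2.2.symm⟩
  · exact (key u u' c h2.2).elim

theorem mul_raise_ne_mul_level (a b u : MPath X) (x : X) :
    a * MPath.level x ≠ b * u.raise := fun h => by
  have := congrArg (fun m => m.steps.getLast?) h
  simp only [steps_mul, steps_raise, steps_level, ← List.cons_append] at this
  rw [← List.append_assoc, List.getLast?_concat, List.getLast?_concat] at this
  simp at this

theorem level_mul_ne_raise_mul (a b u : MPath X) (x : X) :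
    MPath.level x * a ≠ u.raise * b := fun h => by
  simpa [steps_mul, steps_raise, steps_level] using congrArg (fun m => m.steps.head?) h

/-- The decompositions chosen in the definition of `pathProd` are the only ones, so the rule holds
for every decomposition. -/
theorem pathProd_isDiamondRule {k : Type u} [CommRing k] (lam : k) :
    IsDiamondRule (X := X) MPath.raise MPath.level lam (pathProd lam) where
  one_left m := by
    rcases pathProd_cases lam 1 m with ⟨a, u, t, b, h, -⟩ | ⟨-, e⟩
    · simpa [steps_mul, steps_raise, steps_one] using congrArg MPath.steps h
    · rw [e, one_mul]
  one_right m := by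
    rcases pathProd_cases lam m 1 with ⟨a, u, t, b, -, h, -⟩ | ⟨-, e⟩
    · simpa [steps_mul, steps_raise, steps_one] using congrArg MPath.steps h
    · rw [e, mul_one]
  gen_left a x m := by
    rcases pathProd_cases lam (a * MPath.level x) m with ⟨a', u, t, b, h, -⟩ | ⟨-, e⟩
    · exact (mul_raise_ne_mul_level _ _ _ _ h).elim
    · exact e
  gen_right m x b := by
    rcases pathProd_cases lam m (MPath.level x * b) with ⟨a', u, t, b, -, h, -⟩ | ⟨-, e⟩
    · exact (level_mul_ne_raise_mul _ _ _ _ h).elim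
    · exact e
  op_op a u t b := by
    rcases pathProd_cases lam (a * u.raise) (t.raise * b) with ⟨a', u', t', b', h, h', e⟩ | ⟨h, -⟩
    · obtain ⟨rfl, rfl⟩ := mul_raise_inj h
      obtain ⟨rfl, rfl⟩ := raise_mul_inj h'
      exact e
    · exact (h ⟨⟨a, u, rfl⟩, t, b, rfl⟩).elim

/-- A path that leaves the axis only at its ends is a level step or a raised path. -/
theorem isLetter_iff_mem_pathIndec (p : MPath X) :
    IsLetter MPath.raise MPath.level p ↔ p ∈ pathIndec X ∧ p ≠ 1 := by
  constructor
  · rintro (⟨x, rfl⟩ | ⟨u, rfl⟩)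
    · refine ⟨fun n h0 h1 => ?_, level_ne_one x⟩
      simp only [steps_level, List.length_cons, List.length_nil] at h1
      omega
    · refine ⟨fun n h0 h1 => ?_, raise_ne_one u⟩
      obtain ⟨n, rfl⟩ := Nat.exists_eq_add_one.mpr h0
      simp only [steps_raise, List.length_cons, List.length_append, List.length_nil] at h1
      rw [steps_raise, List.take_succ_cons, List.take_append_of_le_length (by omega)]
      have : 0 ≤ height (u.steps.take n) := u.2.1 n
      simp only [height, List.map_cons, List.sum_cons, Step.rise] at this ⊢
      omega
  · rintro ⟨hp, hp1⟩
    obtain ⟨q, b, hq, rfl⟩ := (motzkin_isLetterGenerated.left p).resolve_left hp1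
    suffices b = 1 by rwa [this, mul_one]
    by_contra hb
    have hq1 : q ≠ 1 := by
      rcases hq with ⟨x, rfl⟩ | ⟨u, rfl⟩
      · exact level_ne_one x
      · exact raise_ne_one u
    have pos : ∀ m : MPath X, m ≠ 1 → 0 < m.steps.length := fun m hm =>
      List.length_pos_iff.mpr fun h => hm (MPath.ext_steps (h.trans steps_one.symm))
    have := hp q.steps.length (pos q hq1) (by
      rw [steps_mul, List.length_append]
      exact Nat.lt_add_of_pos_right (pos b hb))
    rw [steps_mul, List.take_left, show height q.steps = 0 from q.2.2] at this
    exact lt_irrefl _ this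

theorem mul_mem_pathV_iff (a b : MPath X) : a * b ∈ pathV X ↔ a ∈ pathV X ∧ b ∈ pathV X ∧
    ¬ (Step.down ∈ a.steps.getLast? ∧ Step.up ∈ b.steps.head?) := by
  simp only [mem_pathV_iff, steps_mul, List.isChain_append]
  refine and_congr_right fun _ => and_congr_right fun _ => ⟨fun h ⟨h1, h2⟩ => ?_, ?_⟩
  · exact h _ h1 _ h2 ⟨rfl, rfl⟩
  · rintro h x hx y hy ⟨rfl, rfl⟩
    exact h ⟨hx, hy⟩

theorem raise_mem_pathV_iff (u : MPath X) : u.raise ∈ pathV X ↔ u ∈ pathV X :=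
  ⟨mem_of_raise_mem_pathV u, raise_mem_pathV u⟩

theorem level_mul_mem_pathV_iff (x : X) (b : MPath X) :
    MPath.level x * b ∈ pathV X ↔ b ∈ pathV X := by
  have : MPath.level x ∈ pathV X := (mem_pathV_iff _).mpr (by simp [steps_level])
  simp [mul_mem_pathV_iff, this, steps_level]

theorem raise_mul_mem_pathV_iff (u b : MPath X) : u.raise * b ∈ pathV X ↔
    u ∈ pathV X ∧ b ∈ pathV X ∧ Step.up ∉ b.steps.head? := by
  have : Step.down ∈ u.raise.steps.getLast? := by
    rw [steps_raise, ← List.cons_append, List.getLast?_concat]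
    rfl
  simp only [mul_mem_pathV_iff, raise_mem_pathV_iff, this, true_and]

theorem mul_mem_pathL_iff {a : MPath X} (ha : a ≠ 1) (b : MPath X) :
    a * b ∈ pathL X ↔ a ∈ pathL X ∧ (b = 1 ∨ b ∈ pathL X) := by
  have h1 : ∀ m : MPath X, m.steps = [] ↔ m = 1 := fun m =>
    ⟨fun h => MPath.ext_steps (h.trans steps_one.symm), fun h => h ▸ steps_one⟩
  by_cases hb : b = 1
  · simp [hb]
  simp only [mem_pathL_iff, steps_mul, List.isChain_append, ne_eq, List.append_eq_nil_iff, h1,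
    ha, hb, not_false_eq_true, true_and, false_and, false_or]
  refine and_congr_right fun _ => and_iff_left fun x hx y _ h => ?_
  exact last_ne_up a (h.1 ▸ hx)

theorem level_mul_mem_pathL_iff (x : X) (b : MPath X) :
    MPath.level x * b ∈ pathL X ↔ b = 1 ∨ b ∈ pathL X := by
  have : MPath.level x ∈ pathL X := (mem_pathL_iff _).mpr (by simp [steps_level])
  simp [mul_mem_pathL_iff (level_ne_one x), this]

theorem raise_mul_mem_pathL_iff (u b : MPath X) :
    u.raise * b ∈ pathL X ↔ u ∈ pathL X ∧ (b = 1 ∨ b ∈ pathL X) := by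
  rw [mul_mem_pathL_iff (raise_ne_one u)]
  exact and_congr_left fun _ => ⟨mem_of_raise_mem_pathL u, raise_mem_pathL u⟩

theorem pathV_isLetterClosed : IsLetterClosed MPath.raise MPath.level (pathV X) where
  left p b _ h := ((mul_mem_pathV_iff p b).mp h).1
  right a p _ h := ((mul_mem_pathV_iff a p).mp h).2.1
  of_op := mem_of_raise_mem_pathV

end Paths

/-! ### Bracketed words and their paths -/

section Words

variable {X : Type v}

/-- `toPath` as a monoid homomorphism. -/
def toPathHom (X : Type v) : BWord X →* MPath X where
  toFun := toPath
  map_one' := toPath_one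
  map_mul' := toPath_mul

theorem words_isLetterGenerated :
    IsLetterGenerated (X := X) BWord.bracket BWord.var (fun W => (toPath W).steps.length) where
  left W := by
    rcases hs : W.toList with _ | ⟨_ | _, l⟩
    · exact Or.inl (FreeMonoid.toList.injective hs)
    · exact Or.inr ⟨_, FreeMonoid.ofList l, Or.inl ⟨_, rfl⟩, FreeMonoid.toList.injective hs⟩
    · exact Or.inr ⟨_, FreeMonoid.ofList l, Or.inr ⟨FreeMonoid.ofList _, rfl⟩,
        FreeMonoid.toList.injective hs⟩
  right W := by
    rcases List.eq_nil_or_concat W.toList with hs | ⟨l, _ | _, hs⟩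
    · exact Or.inl (FreeMonoid.toList.injective hs)
    · exact Or.inr ⟨FreeMonoid.ofList l, _, Or.inl ⟨_, rfl⟩,
        FreeMonoid.toList.injective (by simpa [BWord.var] using hs)⟩
    · exact Or.inr ⟨FreeMonoid.ofList l, _, Or.inr ⟨FreeMonoid.ofList _, rfl⟩,
        FreeMonoid.toList.injective (by simpa [BWord.bracket] using hs)⟩
  size_mul a b := by simp [toPath_mul, steps_mul]
  size_gen x := by simp [toPath_var, steps_level]
  size_op u := by
    simp only [toPath_bracket, steps_raise, List.length_cons, List.length_append]
    omega

theorem toPath_injective : Function.Injective (toPath (X := X)) := by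
  intro W
  induction W using words_isLetterGenerated.induction with
  | one =>
    intro W' h
    rcases words_isLetterGenerated.left W' with rfl | ⟨p, b, ⟨x, rfl⟩ | ⟨u, rfl⟩, rfl⟩
    · rfl
    all_goals
      simpa [toPath_one, toPath_mul, toPath_var, toPath_bracket, steps_mul, steps_one, steps_level,
        steps_raise] using congrArg MPath.steps h
  | gen_mul x b ih =>
    intro W' h
    rcases words_isLetterGenerated.left W' with rfl | ⟨p, b', ⟨x', rfl⟩ | ⟨u', rfl⟩, rfl⟩
    · simpa [toPath_one, toPath_mul, toPath_var, steps_mul, steps_one, steps_level]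
        using congrArg MPath.steps h
    · rw [toPath_mul, toPath_mul, toPath_var, toPath_var] at h
      have hs := congrArg MPath.steps h
      simp only [steps_mul, steps_level, List.cons_append, List.nil_append, List.cons.injEq,
        Step.level.injEq] at hs
      rw [hs.1, ih (MPath.ext_steps hs.2)]
    · rw [toPath_mul, toPath_mul, toPath_var, toPath_bracket] at h
      exact (level_mul_ne_raise_mul _ _ _ _ h).elim
  | op_mul u b ihu ihb =>
    intro W' h
    rcases words_isLetterGenerated.left W' with rfl | ⟨p, b', ⟨x', rfl⟩ | ⟨u', rfl⟩, rfl⟩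
    · simpa [toPath_one, toPath_mul, toPath_bracket, steps_mul, steps_one, steps_raise]
        using congrArg MPath.steps h
    · rw [toPath_mul, toPath_mul, toPath_var, toPath_bracket] at h
      exact (level_mul_ne_raise_mul _ _ _ _ h.symm).elim
    · rw [toPath_mul, toPath_mul, toPath_bracket, toPath_bracket] at h
      obtain ⟨h1, h2⟩ := raise_mul_inj h
      rw [ihu h1, ihb h2]

theorem toPath_surjective : Function.Surjective (toPath (X := X)) := by
  intro m
  induction m using motzkin_isLetterGenerated.induction with
  | one => exact ⟨1, toPath_one⟩
  | gen_mul x b ih =>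
    obtain ⟨W, rfl⟩ := ih
    exact ⟨BWord.var x * W, by rw [toPath_mul, toPath_var]⟩
  | op_mul u b ihu ihb =>
    obtain ⟨U, rfl⟩ := ihu
    obtain ⟨W, rfl⟩ := ihb
    exact ⟨BWord.bracket U * W, by rw [toPath_mul, toPath_bracket]⟩

theorem wordProd_isDiamondRule {k : Type u} [CommRing k] (lam : k) :
    IsDiamondRule (X := X) BWord.bracket BWord.var lam
      (fun W W' => wordProd lam W.toList W'.toList) where
  one_left W := by
    rcases wordProd_cases lam [] W.toList with ⟨A, U, T, B, h, -⟩ | ⟨-, e⟩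
    · simp at h
    · exact e
  one_right W := by
    rcases wordProd_cases lam W.toList [] with ⟨A, U, T, B, -, h⟩ | ⟨-, e⟩
    · simp at h
    · simpa using e
  gen_left A x W := by
    rcases wordProd_cases lam (A * BWord.var x).toList W.toList with
      ⟨A', U, T, B, h, -⟩ | ⟨-, e⟩
    · simp [BWord.var] at h
    · exact e
  gen_right W x B := by
    rcases wordProd_cases lam W.toList (BWord.var x * B).toList with
      ⟨A', U, T, B, -, h⟩ | ⟨-, e⟩
    · simp [BWord.var] at h
    · exact e
  op_op A U T B := wordProd_br lam A.toList B.toList U.toList T.toList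

theorem isLetter_iff_mem_wordIndec (W : BWord X) :
    IsLetter BWord.bracket BWord.var W ↔ W ∈ wordIndec X ∧ W ≠ 1 := by
  constructor
  · rintro (⟨x, rfl⟩ | ⟨U, rfl⟩)
    · exact ⟨Or.inr (Or.inl ⟨x, rfl⟩), FreeMonoid.of_ne_one _⟩
    · exact ⟨Or.inr (Or.inr ⟨U, rfl⟩), FreeMonoid.of_ne_one _⟩
  · rintro ⟨rfl | ⟨x, rfl⟩ | ⟨U, rfl⟩, h⟩
    · exact (h rfl).elim
    · exact Or.inl ⟨x, rfl⟩
    · exact Or.inr ⟨U, rfl⟩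

theorem mem_wordR_iff (W : BWord X) : W ∈ wordR X ↔
    W.toList.IsChain (fun a b => ¬ (a.IsBracket ∧ b.IsBracket)) ∧
      ∀ U, BLetter.br U ∈ W.toList → FreeMonoid.ofList U ∈ wordR X :=
  isRB_iff W.toList

theorem mem_wordS_iff (W : BWord X) : W ∈ wordS X ↔
    W.toList ≠ [] ∧ ∀ U, BLetter.br U ∈ W.toList → FreeMonoid.ofList U ∈ wordS X :=
  isNonunitary_iff W.toList

theorem var_mul_mem_wordR_iff (x : X) (B : BWord X) :
    BWord.var x * B ∈ wordR X ↔ B ∈ wordR X := by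
  rw [mem_wordR_iff, mem_wordR_iff]
  simp [BWord.var, List.isChain_cons, BLetter.IsBracket]

theorem bracket_mul_mem_wordR_iff (U B : BWord X) : BWord.bracket U * B ∈ wordR X ↔
    U ∈ wordR X ∧ B ∈ wordR X ∧ ∀ a ∈ B.toList.head?, ¬ a.IsBracket := by
  rw [mem_wordR_iff, mem_wordR_iff B]
  simp [BWord.bracket, List.isChain_cons, BLetter.IsBracket]
  tauto

theorem var_mul_mem_wordS_iff (x : X) (B : BWord X) :
    BWord.var x * B ∈ wordS X ↔ B = 1 ∨ B ∈ wordS X := by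
  rw [mem_wordS_iff, mem_wordS_iff B]
  by_cases hB : B = 1
  · simp [BWord.var, hB]
  · have : B.toList ≠ [] := fun h => hB (FreeMonoid.toList.injective h)
    simp [BWord.var, hB, this]

theorem bracket_mul_mem_wordS_iff (U B : BWord X) :
    BWord.bracket U * B ∈ wordS X ↔ U ∈ wordS X ∧ (B = 1 ∨ B ∈ wordS X) := by
  rw [mem_wordS_iff, mem_wordS_iff B]
  by_cases hB : B = 1
  · simp [BWord.bracket, hB]
  · have : B.toList ≠ [] := fun h => hB (FreeMonoid.toList.injective h)
    simp [BWord.bracket, hB, this]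

theorem up_mem_head?_toPath_iff (W : BWord X) :
    Step.up ∈ (toPath W).steps.head? ↔ ∃ a ∈ W.toList.head?, a.IsBracket := by
  rcases words_isLetterGenerated.left W with rfl | ⟨p, b, ⟨x, rfl⟩ | ⟨u, rfl⟩, rfl⟩
  · simp [toPath_one, steps_one]
  · rw [toPath_mul, toPath_var, steps_mul, steps_level]
    simp [BWord.var, BLetter.IsBracket]
  · rw [toPath_mul, toPath_bracket, steps_mul, steps_raise]
    simp [BWord.bracket, BLetter.IsBracket]

/-- A valley of the path is a closing bracket followed by an opening one. -/
theorem toPath_mem_pathV_iff (W : BWord X) : toPath W ∈ pathV X ↔ W ∈ wordR X := by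
  induction W using words_isLetterGenerated.induction with
  | one => simp [toPath_one, one_mem_pathV, one_mem_wordR]
  | gen_mul x b ih =>
    rw [toPath_mul, toPath_var, level_mul_mem_pathV_iff, var_mul_mem_wordR_iff, ih]
  | op_mul u b ihu ihb =>
    rw [toPath_mul, toPath_bracket, raise_mul_mem_pathV_iff, bracket_mul_mem_wordR_iff, ihu, ihb,
      up_mem_head?_toPath_iff]
    push Not
    rfl

/-- A peak of the path is an empty bracket of the word. -/
theorem toPath_mem_pathL_iff (W : BWord X) : toPath W ∈ pathL X ↔ W ∈ wordS X := by
  have h1 : ∀ W : BWord X, toPath W = 1 ↔ W = 1 := fun W =>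
    ⟨fun h => toPath_injective (h.trans toPath_one.symm), fun h => h ▸ toPath_one⟩
  induction W using words_isLetterGenerated.induction with
  | one =>
    rw [toPath_one, mem_wordS_iff]
    simp [pathL]
  | gen_mul x b ih =>
    rw [toPath_mul, toPath_var, level_mul_mem_pathL_iff, var_mul_mem_wordS_iff]
    exact or_congr (h1 b) ih
  | op_mul u b ihu ihb =>
    rw [toPath_mul, toPath_bracket, raise_mul_mem_pathL_iff, bracket_mul_mem_wordS_iff]
    exact and_congr ihu (or_congr (h1 b) ihb)

theorem bijOn_toPath {Y : Set (BWord X)} {Z : Set (MPath X)} (h : ∀ W, toPath W ∈ Z ↔ W ∈ Y) :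
    Set.BijOn toPath Y Z := by
  refine ⟨fun W hW => (h W).mpr hW, toPath_injective.injOn, fun m hm => ?_⟩
  obtain ⟨W, rfl⟩ := toPath_surjective m
  exact ⟨W, (h W).mp hm, rfl⟩

theorem wordR_isLetterClosed : IsLetterClosed BWord.bracket BWord.var (wordR X) where
  left p b _ h := by
    rw [← toPath_mem_pathV_iff, toPath_mul, mul_mem_pathV_iff] at h
    exact (toPath_mem_pathV_iff p).mp h.1
  right a p _ h := by
    rw [← toPath_mem_pathV_iff, toPath_mul, mul_mem_pathV_iff] at h
    exact (toPath_mem_pathV_iff p).mp h.2.1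
  of_op u h := by
    rw [← toPath_mem_pathV_iff, toPath_bracket, raise_mem_pathV_iff] at h
    exact (toPath_mem_pathV_iff u).mp h

theorem wordS_isLetterClosed : IsLetterClosed BWord.bracket BWord.var (wordS X) where
  left p b hp h := by
    rcases hp with ⟨x, rfl⟩ | ⟨u, rfl⟩
    · exact (var_mem_wordSR x).1
    · exact bracket_mem_wordS u ((bracket_mul_mem_wordS_iff u b).mp h).1
  right a p hp h := by
    rcases hp with ⟨x, rfl⟩ | ⟨u, rfl⟩
    · exact (var_mem_wordSR x).1
    · exact bracket_mem_wordS u (((mem_wordS_iff _).mp h).2 u.toList (by simp [BWord.bracket]))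
  of_op u h := by
    rw [← mul_one u.bracket, bracket_mul_mem_wordS_iff] at h
    exact h.1

theorem wordSR_isLetterClosed :
    IsLetterClosed BWord.bracket BWord.var (wordS X ∩ wordR X) where
  left p b hp h := ⟨wordS_isLetterClosed.left p b hp h.1, wordR_isLetterClosed.left p b hp h.2⟩
  right a p hp h := ⟨wordS_isLetterClosed.right a p hp h.1, wordR_isLetterClosed.right a p hp h.2⟩
  of_op u h := ⟨wordS_isLetterClosed.of_op u h.1, wordR_isLetterClosed.of_op u h.2⟩

end Words

/-! ### Isomorphism of the two models -/

section Isomorphism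

variable {X : Type v}

/-- `toPath` as a bijection. -/
noncomputable def toPathEquiv (X : Type v) : BWord X ≃ MPath X :=
  Equiv.ofBijective toPath ⟨toPath_injective, toPath_surjective⟩

theorem mapDomain_toPath_bilin {k : Type u} [CommRing k] (lam : k) (a b : BWord X →₀ k) :
    Finsupp.mapDomain toPath (bilin (fun W W' => wordProd lam W.toList W'.toList) a b) =
      bilin (pathProd lam) (Finsupp.mapDomain toPath a) (Finsupp.mapDomain toPath b) :=
  (wordProd_isDiamondRule lam).mapDomain_bilin (pathProd_isDiamondRule lam)
    words_isLetterGenerated (toPathHom X) toPath_bracket toPath_var a b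

theorem mapDomain_toPath_bracket {k : Type u} [CommRing k] (a : BWord X →₀ k) :
    Finsupp.mapDomain toPath (Finsupp.mapDomain BWord.bracket a) =
      Finsupp.mapDomain MPath.raise (Finsupp.mapDomain toPath a) := by
  rw [← Finsupp.mapDomain_comp, ← Finsupp.mapDomain_comp]
  exact congrArg (Finsupp.mapDomain · a) (funext toPath_bracket)

end Isomorphism

/-! ### Freeness -/

section Freeness

variable {k : Type u} [CommRing k] {X : Type v}

mutual
/-- The value of a letter when `x` is replaced by `j x` and the bracket by `q`. -/
def BLetter.eval {B : Type*} [Monoid B] (j : X → B) (q : B → B) : BLetter X → B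
  | .var x => j x
  | .br W => q (listEval j q W)
/-- The product of the values of the letters of a word. -/
def listEval {B : Type*} [Monoid B] (j : X → B) (q : B → B) : List (BLetter X) → B
  | [] => 1
  | a :: W => a.eval j q * listEval j q W
end

/-- The homomorphism of operated monoids from bracketed words to `(B, q)` that extends
`j : X → B`. -/
def wordEval {B : Type*} [Monoid B] (j : X → B) (q : B → B) : BWord X →* B where
  toFun W := listEval j q W.toList
  map_one' := by simp [listEval]
  map_mul' W W' := by
    rw [FreeMonoid.toList_mul]
    induction W.toList with
    | nil => simp [listEval]
    | cons a l ih => simp [listEval, ih, mul_assoc]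

theorem wordEval_var {B : Type*} [Monoid B] (j : X → B) (q : B → B) (x : X) :
    wordEval j q (BWord.var x) = j x := by
  simp [wordEval, BWord.var, listEval, BLetter.eval]

theorem wordEval_bracket {B : Type*} [Monoid B] (j : X → B) (q : B → B) (W : BWord X) :
    wordEval j q W.bracket = q (wordEval j q W) := by
  simp [wordEval, BWord.bracket, listEval, BLetter.eval]

/-- A Rota--Baxter word is the diamond product of its letters, since no two consecutive letters
are brackets. Hence a homomorphism is determined by its values on `X` (and on `1`). -/
theorem rbHom_ext {lam : k} {Y : Set (BWord X)} (hYR : Y ⊆ wordR X)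
    (hY : IsLetterClosed BWord.bracket BWord.var Y)
    (htail : ∀ p W, IsLetter BWord.bracket BWord.var p → p * W ∈ Y → W = 1 ∨ W ∈ Y)
    (hfY : ∀ W ∈ Y, ∀ W' ∈ Y, wordProd lam W.toList W'.toList ∈ kSpan k Y)
    (hop : ∀ W ∈ Y, BWord.bracket W ∈ Y)
    {B : Type*} [NonUnitalNonAssocSemiring B] [Module k B] {Q : B → B} {F G : kSpan k Y →ₗ[k] B}
    (one : ∀ h, F (bas k 1 h) = G (bas k 1 h))
    (var : ∀ x h, F (bas k (BWord.var x) h) = G (bas k (BWord.var x) h))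
    (mulF : ∀ a b, F (bilinOn (fun W W' => wordProd lam W.toList W'.toList) hfY a b) = F a * F b)
    (mulG : ∀ a b, G (bilinOn (fun W W' => wordProd lam W.toList W'.toList) hfY a b) = G a * G b)
    (opF : ∀ a, F (opOn BWord.bracket hop a) = Q (F a))
    (opG : ∀ a, G (opOn BWord.bracket hop a) = Q (G a)) : F = G := by
  have hf := wordProd_isDiamondRule (X := X) lam
  -- If the product of a letter and a word is their concatenation, the two factors suffice.
  have step : ∀ (p W : BWord X) (hp : p ∈ Y) (h : p * W ∈ Y), (W = 1 ∨ W ∈ Y) →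
      (F (bas k p hp) = G (bas k p hp)) → (∀ hW, F (bas k W hW) = G (bas k W hW)) →
      wordProd lam p.toList W.toList = Finsupp.single (p * W) 1 →
      F (bas k (p * W) h) = G (bas k (p * W) h) := by
    intro p W hp h hW ep eW e
    rcases hW with rfl | hW
    · simpa only [mul_one] using ep
    · have : bas k (p * W) h = bilinOn (fun W W' => wordProd lam W.toList W'.toList) hfY
          (bas k p hp) (bas k W hW) := Subtype.ext ((coe_bilinOn_bas hfY hp hW).trans e).symm
      rw [this, mulF, mulG, ep, eW]
  refine kSpan_hom_ext fun W hW => ?_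
  induction W using words_isLetterGenerated.induction with
  | one => exact one hW
  | gen_mul x W ih =>
    have hl : IsLetter BWord.bracket BWord.var (BWord.var x) := Or.inl ⟨x, rfl⟩
    refine step _ _ (hY.left _ _ hl hW) hW (htail _ _ hl hW) (var x _) ih ?_
    simpa using hf.gen_left 1 x W
  | op_mul U W ihU ihW =>
    have hl : IsLetter BWord.bracket BWord.var (BWord.bracket U) := Or.inr ⟨U, rfl⟩
    have hb := hY.left _ _ hl hW
    have hU := hY.of_op U hb
    refine step _ _ hb hW (htail _ _ hl hW) ?_ ihW ?_
    · rw [← opOn_bas hop hU, opF, opG, ihU hU]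
    · rcases words_isLetterGenerated.left W with rfl | ⟨p, C, ⟨x, rfl⟩ | ⟨T, rfl⟩, rfl⟩
      · simpa using hf.one_right U.bracket
      · exact hf.gen_right U.bracket x C
      · have := ((bracket_mul_mem_wordR_iff _ _).mp (hYR hW)).2.2
        exact (this (BLetter.br T.toList) (by simp [BWord.bracket]) trivial).elim

theorem linearCombination_bas {B : Type*} [AddCommMonoid B] [Module k B] {Y : Set (BWord X)}
    (e : BWord X → B) {W : BWord X} (hW : W ∈ Y) :
    Finsupp.linearCombination k e (bas k W hW : BWord X →₀ k) = e W := by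
  simp [coe_bas]

/-- It suffices to check on basis elements that a linear map is multiplicative. -/
theorem map_mul_of_bas {M : Type v} {Y : Set M} {B : Type*} [NonUnitalNonAssocSemiring B]
    [Module k B] [IsScalarTower k B B] [SMulCommClass k B B]
    {mul : kSpan k Y →ₗ[k] kSpan k Y →ₗ[k] kSpan k Y} {F : kSpan k Y →ₗ[k] B}
    (h : ∀ m m' hm hm', F (mul (bas k m hm) (bas k m' hm')) = F (bas k m hm) * F (bas k m' hm'))
    (a b : kSpan k Y) : F (mul a b) = F a * F b := by
  have : mul.compr₂ F = (LinearMap.mul k B).compl₁₂ F F :=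
    kSpan_hom_ext fun m hm => kSpan_hom_ext fun m' hm' => h m m' hm hm'
  exact LinearMap.congr_fun₂ this a b

theorem isFreeRBAlgebra_wordR (lam : k) :
    IsFreeRBAlgebra.{u, v, w} lam (mulR k X lam) (bas k 1 one_mem_wordR) (opR k X)
      (fun x : X => bas k (BWord.var x) (var_mem_wordSR x).2) where
  isRBAlgebra := (wordProd_isDiamondRule lam).isRBAlgebra words_isLetterGenerated one_mem_wordR _ _
  lift := by
    intro B _ _ Q hQ f
    refine existsUnique_of_exists_of_unique ?_ ?_
    · refine ⟨Finsupp.linearCombination k (wordEval f Q) ∘ₗ (kSpan k (wordR X)).subtype,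
        ?_, map_mul_of_bas fun W W' hW hW' => ?_, fun a => ?_, fun x => ?_⟩
      · simp [coe_bas]
      · simp only [LinearMap.comp_apply, Submodule.subtype_apply, linearCombination_bas]
        rw [mulR, coe_bilinOn_bas]
        exact (wordProd_isDiamondRule lam).linearCombination_mul words_isLetterGenerated
          wordR_isLetterClosed (wordEval f Q) Q (fun U _ => wordEval_bracket f Q U)
          (fun U _ T _ => hQ _ _) (wordProd_mem_R lam) hW hW'
      · have : (Finsupp.linearCombination k (wordEval f Q) ∘ₗ (kSpan k (wordR X)).subtype) ∘ₗ
            opR k X = Q ∘ₗ Finsupp.linearCombination k (wordEval f Q) ∘ₗ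
              (kSpan k (wordR X)).subtype := by
          refine kSpan_hom_ext fun W hW => ?_
          simp only [LinearMap.comp_apply, opR, opOn_bas, Submodule.subtype_apply,
            linearCombination_bas, wordEval_bracket]
        exact LinearMap.congr_fun this a
      · simp only [LinearMap.comp_apply, Submodule.subtype_apply, linearCombination_bas,
          wordEval_var]
    · rintro F G ⟨hF1, hF2, hF3, hF4⟩ ⟨hG1, hG2, hG3, hG4⟩
      refine rbHom_ext subset_rfl wordR_isLetterClosed (fun p W hp h => Or.inr ?_)
        (wordProd_mem_R lam) bracket_mem_wordR (fun _ => hF1.trans hG1.symm)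
        (fun x _ => (hF4 x).trans (hG4 x).symm) hF2 hG2 hF3 hG3
      rcases hp with ⟨x, rfl⟩ | ⟨U, rfl⟩
      · exact (var_mul_mem_wordR_iff x W).mp h
      · exact ((bracket_mul_mem_wordR_iff U W).mp h).2.1

/-- Existence evaluates words in the unitization `k ⊕ B`, with the operator `Q` on `B` and `0` on
`k`. It is not a Rota--Baxter operator in general, but the identity is only needed on the
values of nonunitary words, which lie in `B`. -/
theorem isFreeNonunitaryRBAlgebra_wordSR (lam : k) :
    IsFreeNonunitaryRBAlgebra.{u, v, w} lam (mulSR k X lam) (opSR k X)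
      (fun x : X => bas k (BWord.var x) (var_mem_wordSR x)) where
  isRBAlgebra := (wordProd_isDiamondRule lam).isNonunitaryRBAlgebra words_isLetterGenerated _ _
  lift := by
    intro B _ _ _ _ Q hQ f
    refine existsUnique_of_exists_of_unique ?_ ?_
    · let P : Unitization k B →ₗ[k] Unitization k B :=
        Unitization.inrHom k k B ∘ₗ Q ∘ₗ Unitization.sndHom k k B
      let e : BWord X →* Unitization k B := wordEval (fun x => (f x : Unitization k B)) P
      have he : ∀ W ∈ wordS X, (e W).fst = 0 := by
        intro W
        induction W using words_isLetterGenerated.induction with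
        | one => intro h; exact ((mem_wordS_iff _).mp h).1.elim rfl
        | gen_mul x W ih => intro _; simp [e, wordEval_var]
        | op_mul U W _ _ => intro _; simp [e, wordEval_bracket, P]
      have he' : ∀ W ∈ wordS X, e W = ((e W).snd : Unitization k B) := fun W hW =>
        Unitization.ext (by simp [he W hW]) (by simp)
      have hbr : ∀ W, e W.bracket = P (e W) := wordEval_bracket _ _
      let F : kSpan k (wordS X ∩ wordR X) →ₗ[k] B :=
        Unitization.sndHom k k B ∘ₗ Finsupp.linearCombination k e ∘ₗ
          (kSpan k (wordS X ∩ wordR X)).subtype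
      have hF : ∀ W hW, F (bas k W hW) = (e W).snd := fun W hW => by
        simp only [F, LinearMap.comp_apply, Submodule.subtype_apply, linearCombination_bas]
        rfl
      refine ⟨F, map_mul_of_bas fun W W' hW hW' => ?_, fun a => ?_, fun x => ?_⟩
      · have key := (wordProd_isDiamondRule lam).linearCombination_mul words_isLetterGenerated
          wordSR_isLetterClosed e P (fun U _ => hbr U) (fun U hU T hT => ?_)
          (wordProd_mem_SR lam) hW hW'
        · rw [hF, hF]
          change (Finsupp.linearCombination k e (mulSR k X lam (bas k W hW) (bas k W' hW')).1).snd
            = _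
          rw [mulSR, coe_bilinOn_bas, key, Unitization.snd_mul, he W hW.1, he W' hW'.1]
          simp
        · rw [he' U hU.1, he' T hT.1]
          have := hQ (e U).snd (e T).snd
          simp only [LinearMap.mul_apply'] at this
          simp only [P, LinearMap.comp_apply, Unitization.inrHom_apply, Unitization.sndHom_apply,
            Unitization.snd_inr, ← Unitization.inr_mul, ← Unitization.inr_add,
            ← Unitization.inr_smul, this]
      · have : F ∘ₗ opSR k X = Q ∘ₗ F := by
          refine kSpan_hom_ext fun W hW => ?_
          simp only [LinearMap.comp_apply, opSR, opOn_bas, hF, hbr]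
          simp [P]
        exact LinearMap.congr_fun this a
      · rw [hF]
        simp [e, wordEval_var]
    · rintro F G ⟨hF2, hF3, hF4⟩ ⟨hG2, hG3, hG4⟩
      refine rbHom_ext Set.inter_subset_right wordSR_isLetterClosed (fun p W hp h => ?_)
        (wordProd_mem_SR lam) bracket_mem_wordSR
        (fun h => (((mem_wordS_iff _).mp h.1).1 rfl).elim)
        (fun x _ => (hF4 x).trans (hG4 x).symm) hF2 hG2 hF3 hG3
      rcases hp with ⟨x, rfl⟩ | ⟨U, rfl⟩
      · exact ((var_mul_mem_wordS_iff x W).mp h.1).imp id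
          fun h' => ⟨h', (var_mul_mem_wordR_iff x W).mp h.2⟩
      · exact ((bracket_mul_mem_wordS_iff U W).mp h.1).2.imp id
          fun h' => ⟨h', ((bracket_mul_mem_wordR_iff U W).mp h.2).2.1⟩

end Freeness
end RotaBaxterWords

theorem corollary6p4 (k : Type u) [CommRing k] (X : Type v) (lam : k) :
    -- the products are characterized by their recursive properties
    (∀ mul, IsDiamond BWord.bracket BWord.var (wordIndec X) (wordR X) lam mul ↔
      mul = mulR k X lam) ∧
    (∀ mul, IsDiamond MPath.raise MPath.level (pathIndec X) (pathV X) lam mul ↔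
      mul = mulV k X lam) ∧
    -- both sides of the two isomorphisms are Rota--Baxter algebras
    IsRBAlgebra lam (mulR k X lam) (bas k 1 one_mem_wordR) (opR k X) ∧
    IsRBAlgebra lam (mulV k X lam) (bas k 1 one_mem_pathV) (opV k X) ∧
    IsNonunitaryRBAlgebra lam (mulSR k X lam) (opSR k X) ∧
    IsNonunitaryRBAlgebra lam (mulLV k X lam) (opLV k X) ∧
    -- the bijection `R(X) → V(X)` and its restriction `S(X) ∩ R(X) → L(X) ∩ V(X)`
    Set.BijOn toPath (wordR X) (pathV X) ∧
    Set.BijOn toPath (wordS X ∩ wordR X) (pathL X ∩ pathV X) ∧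
    -- the isomorphism of Rota--Baxter algebras and its restriction
    (∃ Φ : kSpan k (wordR X) ≃ₗ[k] kSpan k (pathV X),
      (∀ W (hW : W ∈ wordR X),
        (Φ (bas k W hW) : MPath X →₀ k) = Finsupp.single (toPath W) 1) ∧
      Φ (bas k 1 one_mem_wordR) = bas k 1 one_mem_pathV ∧
      (∀ a b, Φ (mulR k X lam a b) = mulV k X lam (Φ a) (Φ b)) ∧
      (∀ a, Φ (opR k X a) = opV k X (Φ a)) ∧
      ∃ Ψ : kSpan k (wordS X ∩ wordR X) ≃ₗ[k] kSpan k (pathL X ∩ pathV X),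
        (∀ (a : kSpan k (wordS X ∩ wordR X)) (ha : (a : BWord X →₀ k) ∈ kSpan k (wordR X)),
          (Ψ a : MPath X →₀ k) = Φ ⟨a, ha⟩) ∧
        (∀ a b, Ψ (mulSR k X lam a b) = mulLV k X lam (Ψ a) (Ψ b)) ∧
        (∀ a, Ψ (opSR k X a) = opLV k X (Ψ a))) ∧
    -- freeness
    IsFreeRBAlgebra.{u, v, w} lam (mulR k X lam) (bas k 1 one_mem_wordR) (opR k X)
      (fun x : X => bas k (BWord.var x) (var_mem_wordSR x).2) ∧
    IsFreeNonunitaryRBAlgebra.{u, v, w} lam (mulSR k X lam) (opSR k X)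
      (fun x : X => bas k (BWord.var x) (var_mem_wordSR x)) := by
  have hw := wordProd_isDiamondRule (X := X) lam
  have hp := pathProd_isDiamondRule (X := X) lam
  have gw := words_isLetterGenerated (X := X)
  have gp := motzkin_isLetterGenerated (X := X)
  have hSR : ∀ W, toPath W ∈ pathL X ∩ pathV X ↔ W ∈ wordS X ∩ wordR X := fun W =>
    and_congr (toPath_mem_pathL_iff W) (toPath_mem_pathV_iff W)
  refine ⟨fun mul => hw.isDiamond_iff gw wordR_isLetterClosed one_mem_wordR (wordProd_mem_R lam)
      isLetter_iff_mem_wordIndec mul,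
    fun mul => hp.isDiamond_iff gp pathV_isLetterClosed one_mem_pathV (pathProd_mem_V lam)
      isLetter_iff_mem_pathIndec mul,
    hw.isRBAlgebra gw one_mem_wordR _ _, hp.isRBAlgebra gp one_mem_pathV _ _,
    hw.isNonunitaryRBAlgebra gw _ _, hp.isNonunitaryRBAlgebra gp _ _,
    bijOn_toPath toPath_mem_pathV_iff, bijOn_toPath hSR,
    ⟨kSpanEquiv k (toPathEquiv X) toPath_mem_pathV_iff, fun W hW => ?_, Subtype.ext ?_,
      fun a b => Subtype.ext (mapDomain_toPath_bilin lam a.1 b.1),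
      fun a => Subtype.ext (mapDomain_toPath_bracket a.1),
      kSpanEquiv k (toPathEquiv X) hSR, fun _ _ => rfl,
      fun a b => Subtype.ext (mapDomain_toPath_bilin lam a.1 b.1),
      fun a => Subtype.ext (mapDomain_toPath_bracket a.1)⟩,
    isFreeRBAlgebra_wordR lam, isFreeNonunitaryRBAlgebra_wordSR lam⟩
  · exact Finsupp.mapDomain_single
  · exact Finsupp.mapDomain_single.trans (congrArg (Finsupp.single · 1) toPath_one)
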